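/- All manifolds are smooth, finite dimensional, Hausdorff, second countable and without boundary. Let a Lie group $G$ act smoothly on a manifold $Q$ so that $\pi:Q\to Q/G$ is a smooth principal $G$-bundle. Write $\xi_Q(q)$ for the infinitesimal generator of $\xi\in\mathfrak g$, $\mathcal V_q=\{\xi_Q(q):\xi\in\mathfrak g\}$ for the vertical space, and $D_1,D_2$ for the partial differentials of a function on a product. Let $(Q,L_d,\mathcal D,\mathcal D_d)$ be a nonholonomic discrete mechanical system: $L_d:Q\times Q\to\mathbb R$ is smooth, $\mathcal D\subset TQ$ is a smooth subbundle and $\mathcal D_d\subset Q\times Q$ is a submanifold. Suppose that $L_d$ and $\mathcal D_d$ are invariant under the diagonal $G$-action, that $\mathcal D$ is invariant under the lifted action, and that $\mathcal V\subset\mathcal D$ (as holds when $G$ is a closed subgroup of a larger symmetry group $M$ with $\mathcal V^M\cap\mathcal D=\mathcal V^G$). Put $J_d(q_0,q_1)\xi=-D_1L_d(q_0,q_1)\,\xi_Q(q_0)$, so that $J_d:Q\times Q\to\mathfrak g^*$. Let $\mu\in\mathfrak g^*$ be such that $G$ is $\mu$-good: the bilinear form $D_2D_1L_d(q_0,q_1)$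 on $T_{q_0}Q\times T_{q_1}Q$ and its restriction to $\mathcal V_{q_0}\times\mathcal V_{q_1}$ are nondegenerate for all $q_0,q_1$, and for each $q\in Q$ there is a unique $g\in G$ with $J_d(q,gq)=\mu$. Assume that $Ad_g^*\mu=\mu$ for all $g\in G$. Let $\mathcal J_\mu=J_d^{-1}(\mu)$, and let $U\subset Q\times Q$ be a $G$-invariant open set that contains all $(q,gq)\in\mathcal J_\mu$ and is such that for all $(q_0,q_1)$ there is at most one $g\in G$ with $(q_0,gq_1)\in\mathcal J_\mu\cap U$. The affine discrete connection with horizontal space $\mathcal J_\mu$, on the domain determined by $U$, is given by its connection form and its horizontal lift: $\mathcal A_d(q_0,q_1)$ is the $g\in G$ with $(q_0,g^{-1}q_1)\in\mathcal J_\mu\cap U$ (if it exists), and $\bar h^{q_0}_d(r_1)$ is the $q_1\in\pi^{-1}(r_1)$ with $(q_0,q_1)\in\mathcal J_\mu\cap U$ (if it exists). Let $TQ=\mathcal W\oplus\mathcal V\oplus\mathcal H$ be a splitting into $G$-invariant smooth subbundles with $\mathcal D=\mathcal V\oplus\mathcal H$, and let $h^q:T_{\pi(q)}(Q/G)\to T_qQ$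 be the horizontal lift of the connection with horizontal space $\mathcal W\oplus\mathcal H$. Let $\tilde G=(Q\times G)/G$ for the action $g(q,w)=(gq,gwg^{-1})$, with quotient map $\rho$. Put $\check L_d(q_0,w_0,r_1)=L_d(q_0,w_0\bar h_d^{q_0}(r_1))$ and $\hat L_d(\rho(q_0,w_0),r_1)=\check L_d(q_0,w_0,r_1)$. With $q_1=w_0\bar h^{q_0}_d(r_1)$, put $$\hat F_d^-(\rho(q_0,w_0),r_1)(\delta r_0)=D_2\check L_d(q_0,w_0,r_1)\,D_1\mathcal A_d(q_0,q_1)\,h^{q_0}(\delta r_0),$$ $$\hat F_d^+(\rho(q_0,w_0),r_1)(\delta r_1)=D_2\check L_d(q_0,w_0,r_1)\,D_2\mathcal A_d(q_0,q_1)\,h^{q_1}(\delta r_1).$$ Let $\hat{\mathcal D}_d\subset\tilde G\times(Q/G)$ be the set of all $(\rho(q_0,\mathcal A_d(q_0,q_1)),\pi(q_1))$ with $(q_0,q_1)\in\mathcal D_d$ in the domain of $\mathcal A_d$. Let $\mathcal Y(r_0,r_1)=(\rho(q_0,e),r_1)$, where $\pi(q_0)=r_0$. The reduced data on $Q/G$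 are $\breve L_d=\hat L_d\circ\mathcal Y$, $\breve{\mathcal D}=d\pi(\mathcal D)$, $\breve{\mathcal D}_d=\mathcal Y^{-1}(\hat{\mathcal D}_d)$ and $\breve F_d^\pm=\mathcal Y^*\hat F_d^\pm$. Then the domain of $\mathcal A_d$ is open and $\mathcal A_d$ is smooth on it; $\hat L_d$, $\hat F_d^{\pm}$ and $\breve{\mathcal D}$ are well defined (independent of the representatives; for $\hat F_d^\pm$, where $\bar h_d^{q_0}(r_1)$ is defined); and $\breve L_d$ is smooth on the open set $(\pi\times\pi)(\mathcal J_\mu\cap U)$. Let $q_\cdot=(q_0,\dots,q_N)$ be a discrete curve in $Q$ with $J_d(q_k,q_{k+1})=\mu$ and $(q_k,q_{k+1})\in U$ for $0\le k<N$, and let $r_k=\pi(q_k)$. Write $S_d(q_\cdot)=\sum_{k=0}^{N-1}L_d(q_k,q_{k+1})$ and $\breve S_d(r_\cdot)=\sum_{k=0}^{N-1}\breve L_d(r_k,r_{k+1})$. The following statements are equivalent. 1. $(q_k,q_{k+1})\in\mathcal D_d$ for $0\le k<N$, and $dS_d(q_\cdot)(\delta q_\cdot)=0$ for all variations with $\delta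 q_0=0$, $\delta q_N=0$ and $\delta q_k\in\mathcal D_{q_k}$ for all $k$. 2. $(q_k,q_{k+1})\in\mathcal D_d$ for $0\le k<N$, and $D_1L_d(q_k,q_{k+1})+D_2L_d(q_{k-1},q_k)$ annihilates $\mathcal D_{q_k}$ for $1\le k\le N-1$. 3. $d\breve S_d(r_\cdot)(\delta r_\cdot)=-\sum_{k=1}^{N-1}\big(\breve F_d^-(r_k,r_{k+1})+\breve F_d^+(r_{k-1},r_k)\big)(\delta r_k)$ for all variations with $\delta r_0=0$, $\delta r_N=0$ and $\delta r_k\in\breve{\mathcal D}_{r_k}$ for all $k$, and $(r_k,r_{k+1})\in\breve{\mathcal D}_d$ for $0\le k<N$. 4. $D_1\breve L_d(r_k,r_{k+1})+D_2\breve L_d(r_{k-1},r_k)+\breve F_d^+(r_{k-1},r_k)+\breve F_d^-(r_k,r_{k+1})$ annihilates $\breve{\mathcal D}_{r_k}$ for $1\le k\le N-1$, and $(r_k,r_{k+1})\in\breve{\mathcal D}_d$ for $0\le k<N$. -/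

import Mathlib

open scoped Manifold ContDiff

noncomputable section

/-! All manifolds are smooth, finite dimensional and without boundary; a manifold `Q` modelled on the
finite-dimensional real vector space `E` carries the model with corners `𝓘(ℝ, E)`. -/

namespace DiscreteReduction

section Differential

variable {E : Type*} [NormedAddCommGroup E] [NormedSpace ℝ E]
  {Q : Type*} [TopologicalSpace Q] [ChartedSpace E Q]

/-- `D₁F(q₀,q₁) : T_{q₀}Q → ℝ`. -/
def partial₁ (F : Q × Q → ℝ) (q₀ q₁ : Q) : TangentSpace 𝓘(ℝ, E) q₀ →ₗ[ℝ] ℝ :=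
  (mfderiv 𝓘(ℝ, E) 𝓘(ℝ, ℝ) (fun q => F (q, q₁)) q₀).toLinearMap

/-- `D₂F(q₀,q₁) : T_{q₁}Q → ℝ`. -/
def partial₂ (F : Q × Q → ℝ) (q₀ q₁ : Q) : TangentSpace 𝓘(ℝ, E) q₁ →ₗ[ℝ] ℝ :=
  (mfderiv 𝓘(ℝ, E) 𝓘(ℝ, ℝ) (fun q => F (q₀, q)) q₁).toLinearMap

/-- `D₂D₁F(q₀,q₁) : T_{q₀}Q × T_{q₁}Q → ℝ`. -/
def partial₂₁ (F : Q × Q → ℝ) (q₀ q₁ : Q)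
    (X₀ : TangentSpace 𝓘(ℝ, E) q₀) (X₁ : TangentSpace 𝓘(ℝ, E) q₁) : ℝ :=
  mfderiv 𝓘(ℝ, E) 𝓘(ℝ, ℝ) (fun q => partial₁ (E := E) F q₀ q X₀) q₁ X₁

/-- The discrete action `S_d(q) = ∑_{k=0}^{N-1} L_d(q_k, q_{k+1})`, a function on `Q^{N+1}`. -/
def action {X : Type*} (L : X × X → ℝ) (N : ℕ) (q : Fin (N + 1) → X) : ℝ :=
  ∑ k : Fin N, L (q k.castSucc, q k.succ)

/-- The differential `dS_d(q)(δq)` of the discrete action on the product manifold `Q^{N+1}`;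
a variation is a tangent vector `δq_k ∈ T_{q_k}Q` for each `k`. -/
def dAction (L : Q × Q → ℝ) (N : ℕ) (q : Fin (N + 1) → Q)
    (δq : ∀ k, TangentSpace 𝓘(ℝ, E) (q k)) : ℝ :=
  mfderiv (ModelWithCorners.pi fun _ : Fin (N + 1) => 𝓘(ℝ, E)) 𝓘(ℝ, ℝ) (action L N) q δq

/-- A variation with vanishing end points, and with `δq_k ∈ D_{q_k}` for all `k`. -/
def IsAdmissible (D : ∀ q : Q, Submodule ℝ (TangentSpace 𝓘(ℝ, E) q)) {N : ℕ}
    (q : Fin (N + 1) → Q) (δq : ∀ k, TangentSpace 𝓘(ℝ, E) (q k)) : Prop :=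
  δq 0 = 0 ∧ δq (Fin.last N) = 0 ∧ ∀ k, δq k ∈ D (q k)

variable [IsManifold 𝓘(ℝ, E) ∞ Q]

/-- A smooth subbundle of the tangent bundle: locally it is spanned by a smooth frame. -/
def IsSubbundle (D : ∀ q : Q, Submodule ℝ (TangentSpace 𝓘(ℝ, E) q)) : Prop :=
  ∀ q₀ : Q, ∃ (O : Set Q) (m : ℕ) (X : Fin m → ∀ q : Q, TangentSpace 𝓘(ℝ, E) q),
    IsOpen O ∧ q₀ ∈ O ∧
    (∀ i, ContMDiffOn 𝓘(ℝ, E) 𝓘(ℝ, E).tangent ∞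
      (fun q => (⟨q, X i q⟩ : TangentBundle 𝓘(ℝ, E) Q)) O) ∧
    ∀ q ∈ O, LinearIndependent ℝ (fun i => X i q) ∧
      D q = Submodule.span ℝ (Set.range fun i => X i q)

end Differential

/-- An (embedded) submanifold: locally the zero set of a smooth submersion to some `ℝᵐ`. -/
def IsSubmanifold {E H : Type*} [NormedAddCommGroup E] [NormedSpace ℝ E] [TopologicalSpace H]
    (I : ModelWithCorners ℝ E H) {M : Type*} [TopologicalSpace M] [ChartedSpace H M]
    (Z : Set M) : Prop :=
  ∀ x ∈ Z, ∃ (O : Set M) (m : ℕ) (f : M → EuclideanSpace ℝ (Fin m)),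
    IsOpen O ∧ x ∈ O ∧ ContMDiffOn I 𝓘(ℝ, EuclideanSpace ℝ (Fin m)) ∞ f O ∧
    Z ∩ O = {y | y ∈ O ∧ f y = 0} ∧
    ∀ y ∈ Z ∩ O, Function.Surjective (mfderiv I 𝓘(ℝ, EuclideanSpace ℝ (Fin m)) f y)

/-- A nonholonomic discrete mechanical system `(Q, L_d, D, D_d)`. -/
structure DiscreteSystem (E : Type*) [NormedAddCommGroup E] [NormedSpace ℝ E]
    (Q : Type*) [TopologicalSpace Q] [ChartedSpace E Q] [IsManifold 𝓘(ℝ, E) ∞ Q] where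
  /-- the discrete lagrangian `L_d` -/
  L : Q × Q → ℝ
  L_smooth : ContMDiff (𝓘(ℝ, E).prod 𝓘(ℝ, E)) 𝓘(ℝ, ℝ) ∞ L
  /-- the variational constraints -/
  D : ∀ q : Q, Submodule ℝ (TangentSpace 𝓘(ℝ, E) q)
  D_subbundle : IsSubbundle D
  /-- the discrete kinematic constraints -/
  Dd : Set (Q × Q)
  Dd_submanifold : IsSubmanifold (𝓘(ℝ, E).prod 𝓘(ℝ, E)) Dd

section Group

variable {EG : Type*} [NormedAddCommGroup EG] [NormedSpace ℝ EG]
  {G : Type*} [TopologicalSpace G] [ChartedSpace EG G] [Group G]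
  {E : Type*} [NormedAddCommGroup E] [NormedSpace ℝ E]
  {Q : Type*} [TopologicalSpace Q] [ChartedSpace E Q] [MulAction G Q]
  {EB : Type*} [NormedAddCommGroup EB] [NormedSpace ℝ EB]
  {B : Type*} [TopologicalSpace B] [ChartedSpace EB B]

variable (EG E EB G Q B) in
/-- The map `π : Q → B = Q/G` is a (smooth, left) principal `G`-bundle. The manifold `B` is the orbit
space: `π` is surjective and its fibres are the orbits. Over small open sets `O ⊆ B` there are
`G`-equivariant diffeomorphisms `π⁻¹(O) ≃ O × G`; in particular the action is free and `π` is a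
submersion, so that the smooth structure of `B` is the one of the quotient. -/
structure PrincipalBundle where
  /-- the projection -/
  π : Q → B
  π_smooth : ContMDiff 𝓘(ℝ, E) 𝓘(ℝ, EB) ∞ π
  π_surjective : Function.Surjective π
  π_eq_iff : ∀ q q' : Q, π q = π q' ↔ ∃ g : G, g • q = q'
  locally_trivial : ∀ b : B, ∃ (O : Set B) (φ : OpenPartialHomeomorph Q (B × G)),
    IsOpen O ∧ b ∈ O ∧ φ.source = π ⁻¹' O ∧ φ.target = O ×ˢ Set.univ ∧
    ContMDiffOn 𝓘(ℝ, E) (𝓘(ℝ, EB).prod 𝓘(ℝ, EG)) ∞ φ φ.source ∧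
    ContMDiffOn (𝓘(ℝ, EB).prod 𝓘(ℝ, EG)) 𝓘(ℝ, E) ∞ φ.symm φ.target ∧
    ∀ q ∈ φ.source, (φ q).1 = π q ∧ ∀ g : G, φ (g • q) = (π q, g * (φ q).2)

/-- The lifted action `dl_g(q) : T_qQ → T_{gq}Q`. -/
def liftedAction (g : G) (q : Q) :
    TangentSpace 𝓘(ℝ, E) q →ₗ[ℝ] TangentSpace 𝓘(ℝ, E) (g • q) :=
  (mfderiv 𝓘(ℝ, E) 𝓘(ℝ, E) (fun x : Q => g • x) q).toLinearMap

variable (EG G) in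
/-- The infinitesimal generators: `ξ ↦ ξ_Q(q)`, the differential at `e` of `g ↦ g q`. -/
def infGen (q : Q) : GroupLieAlgebra 𝓘(ℝ, EG) G →ₗ[ℝ] TangentSpace 𝓘(ℝ, E) q :=
  (mfderiv 𝓘(ℝ, EG) 𝓘(ℝ, E) (fun g : G => g • q) (1 : G)).toLinearMap

variable (EG G E) in
/-- The vertical space `V^G_q`, tangent to the orbit through `q`. -/
def vertical (q : Q) : Submodule ℝ (TangentSpace 𝓘(ℝ, E) q) :=
  LinearMap.range (infGen (E := E) EG G q)

/-- The adjoint action `Ad_g` on the Lie algebra, the differential at `e` of `h ↦ g h g⁻¹`. -/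
def Ad (g : G) : GroupLieAlgebra 𝓘(ℝ, EG) G →ₗ[ℝ] GroupLieAlgebra 𝓘(ℝ, EG) G :=
  (mfderiv 𝓘(ℝ, EG) 𝓘(ℝ, EG) (fun h : G => g * h * g⁻¹) (1 : G)).toLinearMap

/-- A family of tangent subspaces is invariant under the lifted action. -/
def IsInvariant (G : Type*) [Group G] [MulAction G Q]
    (D : ∀ q : Q, Submodule ℝ (TangentSpace 𝓘(ℝ, E) q)) : Prop :=
  ∀ (g : G) (q : Q), ∀ v ∈ D q, liftedAction g q v ∈ D (g • q)

section System

variable [IsManifold 𝓘(ℝ, E) ∞ Q]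

/-- `L_d` and `D_d` are invariant under the diagonal action, `D` under the lifted action. -/
structure IsSymmetryGroup (G : Type*) [Group G] [MulAction G Q] (S : DiscreteSystem E Q) : Prop where
  L_inv : ∀ (g : G) (q₀ q₁ : Q), S.L (g • q₀, g • q₁) = S.L (q₀, q₁)
  Dd_inv : ∀ (g : G) (q₀ q₁ : Q), (q₀, q₁) ∈ S.Dd → (g • q₀, g • q₁) ∈ S.Dd
  D_inv : IsInvariant G S.D

/-- The discrete momentum map `J_d(q₀,q₁) ξ = -D₁L_d(q₀,q₁) ξ_Q(q₀)`. -/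
def momentum (S : DiscreteSystem E Q) (q₀ q₁ : Q) : GroupLieAlgebra 𝓘(ℝ, EG) G →ₗ[ℝ] ℝ :=
  -(partial₁ (E := E) S.L q₀ q₁ ∘ₗ infGen EG G q₀)

/-- `𝒥_μ = J_d⁻¹(μ)`. -/
def momentumLevel (S : DiscreteSystem E Q) (μ : GroupLieAlgebra 𝓘(ℝ, EG) G →ₗ[ℝ] ℝ) :
    Set (Q × Q) :=
  {p | momentum S p.1 p.2 = μ}

/-- `L_d` is regular: the bilinear form `D₂D₁L_d(q₀,q₁)` is nondegenerate everywhere. -/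
def IsRegular (S : DiscreteSystem E Q) : Prop :=
  ∀ (q₀ q₁ : Q) (X₀ : TangentSpace 𝓘(ℝ, E) q₀),
    (∀ X₁ : TangentSpace 𝓘(ℝ, E) q₁, partial₂₁ S.L q₀ q₁ X₀ X₁ = 0) → X₀ = 0

variable (EG G) in
/-- `L_d` is `G`-regular: the restriction of `D₂D₁L_d(q₀,q₁)` to `V_{q₀} × V_{q₁}` is nondegenerate
everywhere. -/
def IsGRegular (S : DiscreteSystem E Q) : Prop :=
  ∀ (q₀ q₁ : Q), ∀ X₀ ∈ vertical EG G E q₀,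
    (∀ X₁ ∈ vertical EG G E q₁, partial₂₁ S.L q₀ q₁ X₀ X₁ = 0) → X₀ = 0

/-- `G` is a group of `μ`-good (horizontal) symmetries of the system. When `G` is a closed subgroup of
a larger symmetry group `M` with `V^M ∩ D = V^G`, the field `horizontal` holds; conversely, this field
is that condition for `M = G`. -/
structure IsMuGood (S : DiscreteSystem E Q) (μ : GroupLieAlgebra 𝓘(ℝ, EG) G →ₗ[ℝ] ℝ) : Prop where
  symmetry : IsSymmetryGroup G S
  horizontal : ∀ q : Q, vertical EG G E q ≤ S.D q
  regular : IsRegular S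
  gregular : IsGRegular EG G S
  existsUnique : ∀ q : Q, ∃! g : G, momentum S q (g • q) = μ

variable (EG G) in
/-- A `G`-invariant splitting `TQ = W ⊕ S ⊕ H` with `S = V^G ⊆ D` and `D = S ⊕ H`. -/
structure Splitting (S : DiscreteSystem E Q) where
  /-- a complement of `D` in `TQ` -/
  W : ∀ q : Q, Submodule ℝ (TangentSpace 𝓘(ℝ, E) q)
  /-- a complement of the vertical space in `D` -/
  H : ∀ q : Q, Submodule ℝ (TangentSpace 𝓘(ℝ, E) q)
  W_subbundle : IsSubbundle W
  H_subbundle : IsSubbundle H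
  W_inv : IsInvariant G W
  H_inv : IsInvariant G H
  W_compl : ∀ q, IsCompl (W q) (S.D q)
  H_disjoint : ∀ q, Disjoint (H q) (vertical EG G E q)
  H_sup : ∀ q, H q ⊔ vertical EG G E q = S.D q

/-- The horizontal space `W ⊕ H` of the nonholonomic connection. -/
def Splitting.hor {S : DiscreteSystem E Q} (T : Splitting EG G S) (q : Q) :
    Submodule ℝ (TangentSpace 𝓘(ℝ, E) q) :=
  T.W q ⊔ T.H q

end System

/-- The differential `dπ(q) : T_qQ → T_{π(q)}B`. -/
def PrincipalBundle.dπ (P : PrincipalBundle EG G E Q EB B) (q : Q) :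
    TangentSpace 𝓘(ℝ, E) q →ₗ[ℝ] TangentSpace 𝓘(ℝ, EB) (P.π q) :=
  (mfderiv 𝓘(ℝ, E) 𝓘(ℝ, EB) P.π q).toLinearMap

open Classical in
/-- The horizontal lift `T_{π(q)}B → T_qQ` of the connection with horizontal space `hor`: the inverse
of `dπ(q)` restricted to the horizontal space at `q` (this restriction is bijective). -/
def horLift (P : PrincipalBundle EG G E Q EB B)
    (hor : ∀ q : Q, Submodule ℝ (TangentSpace 𝓘(ℝ, E) q)) (q : Q) :
    TangentSpace 𝓘(ℝ, EB) (P.π q) →ₗ[ℝ] TangentSpace 𝓘(ℝ, E) q :=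
  if h : Function.Bijective ((P.dπ q).domRestrict (hor q)) then
    (hor q).subtype ∘ₗ ((LinearEquiv.ofBijective _ h).symm : _ →ₗ[ℝ] hor q)
  else 0

/-! ### The affine discrete connection with a given horizontal space -/

variable (G) in
/-- `U` is a domain for the affine discrete connection with horizontal space `Hor ⊆ Q × Q`: a
`G`-invariant open neighbourhood of the level set `Γ = Hor ∩ {(q, g q)}`, such that for all
`(q₀,q₁)` there is at most one `g` with `(q₀, g q₁) ∈ Hor ∩ U`. -/
structure IsConnectionDomain (Hor U : Set (Q × Q)) : Prop where
  isOpen : IsOpen U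
  invariant : ∀ (g : G) (q₀ q₁ : Q), (q₀, q₁) ∈ U → (g • q₀, g • q₁) ∈ U
  level_mem : ∀ (g : G) (q : Q), (q, g • q) ∈ Hor → (q, g • q) ∈ U
  unique : ∀ (q₀ q₁ : Q) (g g' : G),
    (q₀, g • q₁) ∈ Hor ∩ U → (q₀, g' • q₁) ∈ Hor ∩ U → g = g'

variable (G) in
/-- The set of all `(q₀,q₁)` that decompose as `(q₀, g q₀) · (q₀, g⁻¹ q₁)` with
`(q₀, g⁻¹ q₁) ∈ Hor ∩ U`. -/
def connDom (Hor U : Set (Q × Q)) : Set (Q × Q) :=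
  {p | ∃ g : G, (p.1, g⁻¹ • p.2) ∈ Hor ∩ U}

open Classical in
variable (G) in
/-- The discrete connection form `𝒜_d`: for `(q₀,q₁) ∈ connDom`, the element `g` of the decomposition
`(q₀,q₁) = (q₀, g q₀) · (q₀, g⁻¹ q₁)`. -/
def connForm (Hor U : Set (Q × Q)) (p : Q × Q) : G :=
  if h : ∃ g : G, (p.1, g⁻¹ • p.2) ∈ Hor ∩ U then h.choose else 1

/-- `D₁𝒜_d(q₀,q₁) : T_{q₀}Q → T_{𝒜_d(q₀,q₁)}G`. -/
def connForm₁ (Hor U : Set (Q × Q)) (q₀ q₁ : Q) :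
    TangentSpace 𝓘(ℝ, E) q₀ →ₗ[ℝ] TangentSpace 𝓘(ℝ, EG) (connForm G Hor U (q₀, q₁)) :=
  (mfderiv 𝓘(ℝ, E) 𝓘(ℝ, EG) (fun q => connForm G Hor U (q, q₁)) q₀).toLinearMap

/-- `D₂𝒜_d(q₀,q₁) : T_{q₁}Q → T_{𝒜_d(q₀,q₁)}G`. -/
def connForm₂ (Hor U : Set (Q × Q)) (q₀ q₁ : Q) :
    TangentSpace 𝓘(ℝ, E) q₁ →ₗ[ℝ] TangentSpace 𝓘(ℝ, EG) (connForm G Hor U (q₀, q₁)) :=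
  (mfderiv 𝓘(ℝ, E) 𝓘(ℝ, EG) (fun q => connForm G Hor U (q₀, q)) q₁).toLinearMap

open Classical in
/-- The second component of the discrete horizontal lift: the `q₁` with `(q₀,q₁) ∈ Hor ∩ U` and
`π(q₁) = r₁`, if there is one. -/
def discLift (P : PrincipalBundle EG G E Q EB B) (Hor U : Set (Q × Q)) (q₀ : Q) (r₁ : B) : Q :=
  if h : ∃ q₁ : Q, (q₀, q₁) ∈ Hor ∩ U ∧ P.π q₁ = r₁ then h.choose else q₀

/-- `F̃₁(q₀,w₀,r₁)`: the discrete horizontal lift moved by `w₀`. -/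
def F₁ (P : PrincipalBundle EG G E Q EB B) (Hor U : Set (Q × Q)) (q₀ : Q) (w₀ : G) (r₁ : B) : Q :=
  w₀ • discLift P Hor U q₀ r₁

/-! ### The reduced system on `G̃ × (Q/G)` -/

variable (G Q) in
/-- The orbit equivalence relation of the action `g (q, w) = (g q, g w g⁻¹)` on `Q × G`. -/
def conjSetoid : Setoid (Q × G) where
  r p p' := ∃ g : G, (g • p.1, g * p.2 * g⁻¹) = p'
  iseqv :=
    { refl := fun p => ⟨1, by simp⟩
      symm := by
        rintro p _ ⟨g, rfl⟩
        exact ⟨g⁻¹, by ext <;> simp [mul_assoc]⟩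
      trans := by
        rintro p _ _ ⟨g, rfl⟩ ⟨h, rfl⟩
        exact ⟨h * g, by ext <;> simp [mul_assoc, mul_smul]⟩ }

variable (G Q) in
/-- The conjugate associated bundle `G̃ = (Q × G)/G`. -/
def ConjBundle : Type _ := Quotient (conjSetoid G Q)

/-- The quotient map `ρ : Q × G → G̃`. -/
def ρ (q : Q) (w : G) : ConjBundle G Q := Quotient.mk (conjSetoid G Q) (q, w)

/-- A representative in `Q × G` of an element of `G̃`. -/
def ConjBundle.rep (v : ConjBundle G Q) : Q × G := Quotient.out v

/-- `Ľ_d(q₀,w₀,r₁) = L_d(q₀, F̃₁(q₀,w₀,r₁))`. -/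
def checkL (P : PrincipalBundle EG G E Q EB B) (L : Q × Q → ℝ) (Hor U : Set (Q × Q))
    (q₀ : Q) (w₀ : G) (r₁ : B) : ℝ :=
  L (q₀, F₁ P Hor U q₀ w₀ r₁)

/-- `D₂Ľ_d(q₀,w₀,r₁) : T_{w₀}G → ℝ`. -/
def checkL₂ (P : PrincipalBundle EG G E Q EB B) (L : Q × Q → ℝ) (Hor U : Set (Q × Q))
    (q₀ : Q) (w₀ : G) (r₁ : B) : TangentSpace 𝓘(ℝ, EG) w₀ →ₗ[ℝ] ℝ :=
  (mfderiv 𝓘(ℝ, EG) 𝓘(ℝ, ℝ) (fun w => checkL P L Hor U q₀ w r₁) w₀).toLinearMap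

/-- `L̂_d(ρ(q₀,w₀),r₁) = Ľ_d(q₀,w₀,r₁)`, computed with a representative. -/
def hatL (P : PrincipalBundle EG G E Q EB B) (L : Q × Q → ℝ) (Hor U : Set (Q × Q))
    (v₀ : ConjBundle G Q) (r₁ : B) : ℝ :=
  checkL P L Hor U v₀.rep.1 v₀.rep.2 r₁

/-- `δr₀ ↦ D₂Ľ_d(q₀,w₀,r₁) D₁𝒜_d(q₀,q₁)(horizontal lift of δr₀ at q₀)`, `q₁ = F̃₁(q₀,w₀,r₁)`. -/
def checkForceMinus (P : PrincipalBundle EG G E Q EB B) (L : Q × Q → ℝ)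
    (hor : ∀ q : Q, Submodule ℝ (TangentSpace 𝓘(ℝ, E) q)) (Hor U : Set (Q × Q))
    (q₀ : Q) (w₀ : G) (r₁ : B) : TangentSpace 𝓘(ℝ, EB) (P.π q₀) →ₗ[ℝ] ℝ :=
  (checkL₂ P L Hor U q₀ w₀ r₁ :
      TangentSpace 𝓘(ℝ, EG) (connForm G Hor U (q₀, F₁ P Hor U q₀ w₀ r₁)) →ₗ[ℝ] ℝ) ∘ₗ
    connForm₁ (EG := EG) (G := G) Hor U q₀ (F₁ P Hor U q₀ w₀ r₁) ∘ₗ horLift P hor q₀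

/-- `δr₁ ↦ D₂Ľ_d(q₀,w₀,r₁) D₂𝒜_d(q₀,q₁)(horizontal lift of δr₁ at q₁)`, `q₁ = F̃₁(q₀,w₀,r₁)`. -/
def checkForcePlus (P : PrincipalBundle EG G E Q EB B) (L : Q × Q → ℝ)
    (hor : ∀ q : Q, Submodule ℝ (TangentSpace 𝓘(ℝ, E) q)) (Hor U : Set (Q × Q))
    (q₀ : Q) (w₀ : G) (r₁ : B) : TangentSpace 𝓘(ℝ, EB) r₁ →ₗ[ℝ] ℝ :=
  (checkL₂ P L Hor U q₀ w₀ r₁ :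
      TangentSpace 𝓘(ℝ, EG) (connForm G Hor U (q₀, F₁ P Hor U q₀ w₀ r₁)) →ₗ[ℝ] ℝ) ∘ₗ
    connForm₂ (EG := EG) (G := G) Hor U q₀ (F₁ P Hor U q₀ w₀ r₁) ∘ₗ
    (horLift P hor (F₁ P Hor U q₀ w₀ r₁) : TangentSpace 𝓘(ℝ, EB) r₁ →ₗ[ℝ] _)

/-- The reduced discrete force `F̂_d⁻(v₀,r₁)`, computed with a representative of `v₀`. -/
def hatForceMinus (P : PrincipalBundle EG G E Q EB B) (L : Q × Q → ℝ)
    (hor : ∀ q : Q, Submodule ℝ (TangentSpace 𝓘(ℝ, E) q)) (Hor U : Set (Q × Q))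
    (v₀ : ConjBundle G Q) (r₁ : B) : TangentSpace 𝓘(ℝ, EB) (P.π v₀.rep.1) →ₗ[ℝ] ℝ :=
  checkForceMinus P L hor Hor U v₀.rep.1 v₀.rep.2 r₁

/-- The reduced discrete force `F̂_d⁺(v₀,r₁)`, computed with a representative of `v₀`. -/
def hatForcePlus (P : PrincipalBundle EG G E Q EB B) (L : Q × Q → ℝ)
    (hor : ∀ q : Q, Submodule ℝ (TangentSpace 𝓘(ℝ, E) q)) (Hor U : Set (Q × Q))
    (v₀ : ConjBundle G Q) (r₁ : B) : TangentSpace 𝓘(ℝ, EB) r₁ →ₗ[ℝ] ℝ :=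
  checkForcePlus P L hor Hor U v₀.rep.1 v₀.rep.2 r₁

/-- `Υ(q₀,q₁) = (ρ(q₀, 𝒜_d(q₀,q₁)), π(q₁))`. -/
def Upsilon (P : PrincipalBundle EG G E Q EB B) (Hor U : Set (Q × Q)) (p : Q × Q) :
    ConjBundle G Q × B :=
  (ρ p.1 (connForm G Hor U p), P.π p.2)

/-- `D̂_d`, the image of `D_d/G` in `G̃ × (Q/G)`. -/
def hatDd (P : PrincipalBundle EG G E Q EB B) (Dd Hor U : Set (Q × Q)) :
    Set (ConjBundle G Q × B) :=
  Upsilon P Hor U '' (Dd ∩ connDom G Hor U)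

/-! ### The reduced system on `Q/G` -/

/-- The inclusion `𝒴(r₀,r₁) = (ρ(q₀,e), r₁)`, where `π(q₀) = r₀`. -/
def incl (P : PrincipalBundle EG G E Q EB B) (p : B × B) : ConjBundle G Q × B :=
  (ρ (Function.surjInv P.π_surjective p.1) 1, p.2)

/-- The domain in `Q/G × Q/G` of the reduced lagrangian and of the reduced force. -/
def breveDom (P : PrincipalBundle EG G E Q EB B) (Hor U : Set (Q × Q)) : Set (B × B) :=
  (fun p : Q × Q => (P.π p.1, P.π p.2)) '' (Hor ∩ U)

/-- `L̆_d = L̂_d ∘ 𝒴`. -/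
def breveL (P : PrincipalBundle EG G E Q EB B) (L : Q × Q → ℝ) (Hor U : Set (Q × Q))
    (p : B × B) : ℝ :=
  hatL P L Hor U (incl P p).1 (incl P p).2

/-- `D̆_r = dπ(D) ∩ T_r(Q/G)`. -/
def breveD (P : PrincipalBundle EG G E Q EB B)
    (D : ∀ q : Q, Submodule ℝ (TangentSpace 𝓘(ℝ, E) q)) (r : B) :
    Submodule ℝ (TangentSpace 𝓘(ℝ, EB) r) :=
  ⨆ q : {q : Q // P.π q = r}, ((D q).map (P.dπ q) : Submodule ℝ (TangentSpace 𝓘(ℝ, EB) (P.π q)))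

/-- `D̆_d = 𝒴⁻¹(D̂_d)`. -/
def breveDd (P : PrincipalBundle EG G E Q EB B) (Dd Hor U : Set (Q × Q)) : Set (B × B) :=
  incl P ⁻¹' hatDd P Dd Hor U

/-- `F̆_d⁻ = 𝒴^*(F̂_d⁻)`. -/
def breveForceMinus (P : PrincipalBundle EG G E Q EB B) (L : Q × Q → ℝ)
    (hor : ∀ q : Q, Submodule ℝ (TangentSpace 𝓘(ℝ, E) q)) (Hor U : Set (Q × Q)) (r₀ r₁ : B) :
    TangentSpace 𝓘(ℝ, EB) r₀ →ₗ[ℝ] ℝ :=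
  hatForceMinus P L hor Hor U (incl P (r₀, r₁)).1 (incl P (r₀, r₁)).2

/-- `F̆_d⁺ = 𝒴^*(F̂_d⁺)`. -/
def breveForcePlus (P : PrincipalBundle EG G E Q EB B) (L : Q × Q → ℝ)
    (hor : ∀ q : Q, Submodule ℝ (TangentSpace 𝓘(ℝ, E) q)) (Hor U : Set (Q × Q)) (r₀ r₁ : B) :
    TangentSpace 𝓘(ℝ, EB) r₁ →ₗ[ℝ] ℝ :=
  hatForcePlus P L hor Hor U (incl P (r₀, r₁)).1 (incl P (r₀, r₁)).2

end Group

/-! ### Variational principles and equations -/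

section Dynamics

variable {E : Type*} [NormedAddCommGroup E] [NormedSpace ℝ E]
  {Q : Type*} [TopologicalSpace Q] [ChartedSpace E Q]

/-- The kinematic constraints `(q_k, q_{k+1}) ∈ D_d` for `0 ≤ k < N`. -/
def SatisfiesConstraints {X : Type*} (Dd : Set (X × X)) {N : ℕ} (q : Fin (N + 1) → X) : Prop :=
  ∀ k : Fin N, (q k.castSucc, q k.succ) ∈ Dd

/-- For `k + 2 ≤ N`, the consecutive indices `k`, `k + 1`, `k + 2` in `{0, …, N}`. -/
abbrev i₀ {N k : ℕ} (h : k + 2 ≤ N) : Fin (N + 1) := ⟨k, by omega⟩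

/-- The middle one of the three indices. -/
abbrev i₁ {N k : ℕ} (h : k + 2 ≤ N) : Fin (N + 1) := ⟨k + 1, by omega⟩

/-- The last one of the three indices. -/
abbrev i₂ {N k : ℕ} (h : k + 2 ≤ N) : Fin (N + 1) := ⟨k + 2, by omega⟩

theorem add_two_le {N : ℕ} (k : Fin (N - 1)) : k.1 + 2 ≤ N := by omega

/-- `dS_d(q)(δq) = 0` for all admissible variations with vanishing end points. -/
def VariationalPrinciple (L : Q × Q → ℝ) (D : ∀ q : Q, Submodule ℝ (TangentSpace 𝓘(ℝ, E) q))
    {N : ℕ} (q : Fin (N + 1) → Q) : Prop :=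
  ∀ δq : ∀ k, TangentSpace 𝓘(ℝ, E) (q k), IsAdmissible D q δq → dAction L N q δq = 0

/-- `D₁L_d(q_k,q_{k+1}) + D₂L_d(q_{k-1},q_k) ∈ D_{q_k}°` for `1 ≤ k ≤ N - 1` (here `k` is shifted
by one). -/
def LagrangeDAlembert (L : Q × Q → ℝ) (D : ∀ q : Q, Submodule ℝ (TangentSpace 𝓘(ℝ, E) q))
    {N : ℕ} (q : Fin (N + 1) → Q) : Prop :=
  ∀ (k : ℕ) (h : k + 2 ≤ N),
    partial₁ L (q (i₁ h)) (q (i₂ h))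
      + partial₂ L (q (i₀ h)) (q (i₁ h))
      ∈ (D (q (i₁ h))).dualAnnihilator

/-- `dS_d(q)(δq) = -∑_{k=1}^{N-1} (f⁻(q_k,q_{k+1}) + f⁺(q_{k-1},q_k))(δq_k)` for all admissible
variations with vanishing end points (`k` is shifted by one in the sum). -/
def ForcedVariationalPrinciple (L : Q × Q → ℝ)
    (D : ∀ q : Q, Submodule ℝ (TangentSpace 𝓘(ℝ, E) q))
    (fm : ∀ q₀ _q₁ : Q, TangentSpace 𝓘(ℝ, E) q₀ →ₗ[ℝ] ℝ)
    (fp : ∀ _q₀ q₁ : Q, TangentSpace 𝓘(ℝ, E) q₁ →ₗ[ℝ] ℝ)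
    {N : ℕ} (q : Fin (N + 1) → Q) : Prop :=
  ∀ δq : ∀ k, TangentSpace 𝓘(ℝ, E) (q k), IsAdmissible D q δq →
    dAction L N q δq =
      -∑ k : Fin (N - 1),
        (fm (q (i₁ (add_two_le k))) (q (i₂ (add_two_le k)))
          + fp (q (i₀ (add_two_le k))) (q (i₁ (add_two_le k)))) (δq (i₁ (add_two_le k)))

/-- `D₁L_d(q_k,q_{k+1}) + D₂L_d(q_{k-1},q_k) + f⁺(q_{k-1},q_k) + f⁻(q_k,q_{k+1}) ∈ D_{q_k}°` for
`1 ≤ k ≤ N - 1` (here `k` is shifted by one). -/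
def ForcedLagrangeDAlembert (L : Q × Q → ℝ)
    (D : ∀ q : Q, Submodule ℝ (TangentSpace 𝓘(ℝ, E) q))
    (fm : ∀ q₀ _q₁ : Q, TangentSpace 𝓘(ℝ, E) q₀ →ₗ[ℝ] ℝ)
    (fp : ∀ _q₀ q₁ : Q, TangentSpace 𝓘(ℝ, E) q₁ →ₗ[ℝ] ℝ)
    {N : ℕ} (q : Fin (N + 1) → Q) : Prop :=
  ∀ (k : ℕ) (h : k + 2 ≤ N),
    partial₁ L (q (i₁ h)) (q (i₂ h))
      + partial₂ L (q (i₀ h)) (q (i₁ h))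
      + fp (q (i₀ h)) (q (i₁ h))
      + fm (q (i₁ h)) (q (i₂ h))
      ∈ (D (q (i₁ h))).dualAnnihilator

end Dynamics

end DiscreteReduction

end

/-! Variations in `D` split into vertical and horizontal ones, and each kind obeys one identity.

Vertical: `D₁L_d(q_k,q_{k+1})` sends `ξ_Q(q_k)` to `-J_d(q_k,q_{k+1})ξ`, and differentiating the
invariance of `L_d` shows that `D₂L_d(q_{k-1},q_k)` sends it to `J_d(q_{k-1},q_k)ξ`. On a curve of
constant momentum `μ` the two cancel (`mfd_snd_infGen`), so vertical variations impose nothing.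

Horizontal: write `L_d(q,q₁) = Φ(q, 𝒜_d(q,q₁))` with `Φ(q,g) = L_d(q, g 𝒜_d(q,q₁)⁻¹ q₁)`. At a pair
in `𝒥_μ ∩ U`, where `𝒜_d = e`, the `q`-derivative of `Φ` is that of `L̆_d ∘ π` and the
`g`-derivative produces the force. Hence `D₁L_d` on a horizontal lift is `D₁L̆_d + F̆_d⁻`, and
similarly in the second variable (`mfd_L_fst_horLift`, `mfd_L_snd_horLift`). Since `dπ` kills `V`
and maps `H` onto `D̆`, the equations upstairs and downstairs agree at each point
(`mem_dualAnnihilator_iff`). The kinematic constraints agree because a pair in the domain lies in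
`𝒥_μ ∩ U` exactly when its `𝒜_d` is `e` (`mem_breveDd_iff`). Each variational principle is
equivalent to its equations by moving one interior point at a time.

Smoothness of `𝒜_d` is the implicit function theorem for `h ↦ J_d(q₀, h q₁)`, whose derivative at
`e` is invertible by `G`-regularity; uniqueness in `U` identifies the local solution with `𝒜_d`
(`exists_smooth_connForm`). Independence of representatives rests on the `Ad`-invariance of `μ`: it
makes `𝒥_μ` invariant under the diagonal action, so that `𝒜_d` is equivariant for conjugation. -/

open scoped Topology

/-! ### Derivatives on manifolds as linear maps of the model spaces -/

section ModelDerivative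

variable {E : Type*} [NormedAddCommGroup E] [NormedSpace ℝ E]
  {H : Type*} [TopologicalSpace H] {I : ModelWithCorners ℝ E H}
  {M : Type*} [TopologicalSpace M] [ChartedSpace H M]
  {E' : Type*} [NormedAddCommGroup E'] [NormedSpace ℝ E']
  {H' : Type*} [TopologicalSpace H'] {I' : ModelWithCorners ℝ E' H'}
  {M' : Type*} [TopologicalSpace M'] [ChartedSpace H' M']
  {E'' : Type*} [NormedAddCommGroup E''] [NormedSpace ℝ E'']
  {H'' : Type*} [TopologicalSpace H''] {I'' : ModelWithCorners ℝ E'' H''}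
  {M'' : Type*} [TopologicalSpace M''] [ChartedSpace H'' M'']

/-- The manifold derivative, as a continuous linear map between the model vector spaces. -/
noncomputable def mfd (I : ModelWithCorners ℝ E H) (I' : ModelWithCorners ℝ E' H') (f : M → M')
    (x : M) : E →L[ℝ] E' :=
  mfderiv I I' f x

theorem HasMFDerivAt.mfd_eq {f : M → M'} {x : M} {f' : E →L[ℝ] E'}
    (h : HasMFDerivAt I I' f x f') : mfd I I' f x = f' :=
  h.mfderiv

theorem MDifferentiableAt.hasMFDerivAt_mfd {f : M → M'} {x : M} (h : MDifferentiableAt I I' f x) :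
    HasMFDerivAt I I' f x (mfd I I' f x :) :=
  h.hasMFDerivAt

theorem Filter.EventuallyEq.mfd_eq {f g : M → M'} {x : M} (h : f =ᶠ[𝓝 x] g) :
    mfd I I' f x = mfd I I' g x :=
  h.mfderiv_eq

theorem mfd_const (x : M) (c : M') : mfd I I' (fun _ : M => c) x = 0 :=
  mfderiv_const

theorem mfd_id (x : M) : mfd I I (fun y : M => y) x = .id ℝ E :=
  mfderiv_id

/-- The base point is given by an equation, because points such as `1 • q` and `q` are only
propositionally equal; `mfd` takes values in maps of the model spaces, so no transport between
tangent spaces arises. -/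
theorem mfd_comp_apply {g : M' → M''} {f : M → M'} {x : M} {y : M'}
    (hg : MDifferentiableAt I' I'' g y) (hf : MDifferentiableAt I I' f x) (hy : f x = y) (v : E) :
    mfd I I'' (fun z => g (f z)) x v = mfd I' I'' g y (mfd I I' f x v) := by
  subst hy
  exact mfderiv_comp_apply x hg hf v

theorem mfd_prod_apply {f : M × M' → M''} {x : M} {y : M'}
    (hf : MDifferentiableAt (I.prod I') I'' f (x, y)) (v : E) (w : E') :
    mfd (I.prod I') I'' f (x, y) (v, w) =
      mfd I I'' (fun z => f (z, y)) x v + mfd I' I'' (fun z => f (x, z)) y w :=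
  mfderiv_prod_eq_add_apply (v := (v, w)) hf

end ModelDerivative

section TwoVariables

variable {E : Type*} [NormedAddCommGroup E] [NormedSpace ℝ E]
  {H : Type*} [TopologicalSpace H] {I : ModelWithCorners ℝ E H}
  {M : Type*} [TopologicalSpace M] [ChartedSpace H M]
  {E₁ : Type*} [NormedAddCommGroup E₁] [NormedSpace ℝ E₁]
  {H₁ : Type*} [TopologicalSpace H₁] {I₁ : ModelWithCorners ℝ E₁ H₁}
  {M₁ : Type*} [TopologicalSpace M₁] [ChartedSpace H₁ M₁]
  {E₂ : Type*} [NormedAddCommGroup E₂] [NormedSpace ℝ E₂]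
  {H₂ : Type*} [TopologicalSpace H₂] {I₂ : ModelWithCorners ℝ E₂ H₂}
  {M₂ : Type*} [TopologicalSpace M₂] [ChartedSpace H₂ M₂]
  {E' : Type*} [NormedAddCommGroup E'] [NormedSpace ℝ E']
  {H' : Type*} [TopologicalSpace H'] {I' : ModelWithCorners ℝ E' H'}
  {M' : Type*} [TopologicalSpace M'] [ChartedSpace H' M']

theorem mfd_comp₂_apply {f : M₁ × M₂ → M'} {a : M → M₁} {b : M → M₂} {x : M} {y : M₁} {z : M₂}
    (hf : MDifferentiableAt (I₁.prod I₂) I' f (y, z)) (ha : MDifferentiableAt I I₁ a x)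
    (hb : MDifferentiableAt I I₂ b x) (hy : a x = y) (hz : b x = z) (v : E) :
    mfd I I' (fun t => f (a t, b t)) x v =
      mfd I₁ I' (fun t => f (t, z)) y (mfd I I₁ a x v) +
        mfd I₂ I' (fun t => f (y, t)) z (mfd I I₂ b x v) := by
  subst hy hz
  have h := (ha.hasMFDerivAt_mfd.prodMk hb.hasMFDerivAt_mfd).mfd_eq
  rw [mfd_comp_apply (f := fun t => (a t, b t)) hf (ha.prodMk hb) rfl v, h]
  exact mfd_prod_apply hf _ _

end TwoVariables

/-! ### Smooth dependence on parameters and implicit functions -/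

section Parametric

variable {E : Type*} [NormedAddCommGroup E] [NormedSpace ℝ E]
  {H : Type*} [TopologicalSpace H] {I : ModelWithCorners ℝ E H}
  {M : Type*} [TopologicalSpace M] [ChartedSpace H M] [IsManifold I ∞ M]
  {E' : Type*} [NormedAddCommGroup E'] [NormedSpace ℝ E']
  {H' : Type*} [TopologicalSpace H'] {I' : ModelWithCorners ℝ E' H'}
  {N : Type*} [TopologicalSpace N] [ChartedSpace H' N] [IsManifold I' ∞ N]
  {V : Type*} [NormedAddCommGroup V] [NormedSpace ℝ V]

/-- The differential in the second variable, at a fixed point, depends smoothly on the first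
variable. -/
theorem ContMDiff.mfd_snd_const {F : M × N → V} (hF : ContMDiff (I.prod I') 𝓘(ℝ, V) ∞ F)
    (n : N) :
    ContMDiff I 𝓘(ℝ, E' →L[ℝ] V) ∞ (fun x => mfd I' 𝓘(ℝ, V) (fun y => F (x, y)) n) := by
  intro x₀
  have : IsManifold I' 1 N := IsManifold.of_le (n := ∞) (by simp)
  have h := ContMDiffAt.mfderiv (I := I') (I' := 𝓘(ℝ, V)) (J := I) (m := ∞) (n := ∞) (x₀ := x₀)
    (fun x y => F (x, y)) (fun _ => n) (hF.contMDiffAt) contMDiffAt_const (by simp)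
  refine h.congr_of_eventuallyEq (Filter.Eventually.of_forall fun x => ?_)
  refine Eq.symm <| (inTangentCoordinates_eq (fun _ => n) (fun x => F (x, n))
    (fun x => mfd I' 𝓘(ℝ, V) (fun y => F (x, y)) n)
    (x₀ := x₀) (x := x) (mem_chart_source _ _) (Set.mem_univ _)).trans ?_
  ext v
  -- The base point in `N` is constant, so the coordinate change goes from a chart to itself and is
  -- the identity.
  have h1 : (tangentBundleCore I' N).coordChange (achart H' n) (achart H' n) n v = v :=
    (tangentBundleCore I' N).coordChange_self _ _ (mem_chart_source H' n) v
  simp only [ContinuousLinearMap.comp_apply]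
  erw [h1]
  erw [tangentBundleCore_coordChange_model_space]
  rfl

end Parametric

section Implicit

variable {E : Type*} [NormedAddCommGroup E] [NormedSpace ℝ E] [CompleteSpace E]
  {H : Type*} [TopologicalSpace H] {I : ModelWithCorners ℝ E H} [I.Boundaryless]
  {M : Type*} [TopologicalSpace M] [ChartedSpace H M] [IsManifold I ∞ M]
  {E' : Type*} [NormedAddCommGroup E'] [NormedSpace ℝ E'] [CompleteSpace E']
  {H' : Type*} [TopologicalSpace H'] {I' : ModelWithCorners ℝ E' H'} [I'.Boundaryless]
  {N : Type*} [TopologicalSpace N] [ChartedSpace H' N] [IsManifold I' ∞ N]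
  {V : Type*} [NormedAddCommGroup V] [NormedSpace ℝ V] [CompleteSpace V]

/-- The implicit function theorem on manifolds without boundary. -/
theorem ContMDiffAt.exists_implicitFunction {F : M × N → V} {m : M} {n : N}
    (hF : ContMDiffAt (I.prod I') 𝓘(ℝ, V) ∞ F (m, n))
    (hbij : Function.Bijective (mfd I' 𝓘(ℝ, V) (fun y => F (m, y)) n)) :
    ∃ φ : M → N, ContMDiffAt I I' ∞ φ m ∧ φ m = n ∧ ∀ᶠ x in 𝓝 m, F (x, φ x) = F (m, n) := by
  set e := extChartAt I m with he
  set e' := extChartAt I' n with he'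
  set f : E × E' → V := fun p => F (e.symm p.1, e'.symm p.2) with hf
  set u : E × E' := (e m, e' n) with hu
  have hm : e.symm (e m) = m := extChartAt_to_inv m
  have hn : e'.symm (e' n) = n := extChartAt_to_inv n
  have hes : ContMDiffAt 𝓘(ℝ, E) I ∞ e.symm (e m) :=
    (contMDiffOn_extChartAt_symm m).contMDiffAt (extChartAt_target_mem_nhds m)
  have hes' : ContMDiffAt 𝓘(ℝ, E') I' ∞ e'.symm (e' n) :=
    (contMDiffOn_extChartAt_symm n).contMDiffAt (extChartAt_target_mem_nhds n)
  have hfc : ContDiffAt ℝ ∞ f u := by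
    rw [← contMDiffAt_iff_contDiffAt]
    have h1 : ContMDiffAt 𝓘(ℝ, E × E') (I.prod I') ∞
        (fun p : E × E' => (e.symm p.1, e'.symm p.2)) u :=
      ContMDiffAt.prodMk (hes.comp u contDiffAt_fst.contMDiffAt)
        (hes'.comp u contDiffAt_snd.contMDiffAt)
    refine ContMDiffAt.comp (g := F) u ?_ h1
    simpa only [hu, hm, hn] using hF
  -- The manifold derivative is the derivative read in the charts at the base point, which is the
  -- second partial of `f` at `u`.
  have hd : fderiv ℝ f u ∘L .inr ℝ E E' = mfd I' 𝓘(ℝ, V) (fun y => F (m, y)) n := by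
    have h1 : HasFDerivAt (fun y => f (e m, y)) (fderiv ℝ f u ∘L .inr ℝ E E') (e' n) :=
      HasFDerivAt.comp (e' n) (hfc.differentiableAt (by simp)).hasFDerivAt
        (hasFDerivAt_prodMk_right (e m) (e' n))
    refine (HasMFDerivAt.mfd_eq (I := I') (I' := 𝓘(ℝ, V)) ⟨?_, ?_⟩).symm
    · exact hF.continuousAt.comp (by fun_prop)
    · refine (h1.congr_of_eventuallyEq (Filter.Eventually.of_forall fun y => ?_)).hasFDerivWithinAt
      simp [hf, writtenInExtChartAt, hm, he', chartAt_self_eq]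
  have hinv : (fderiv ℝ f u ∘L .inr ℝ E E').IsInvertible := by
    rw [hd]
    exact ⟨ContinuousLinearEquiv.ofBijective _ (LinearMap.ker_eq_bot.2 hbij.1)
      (LinearMap.range_eq_top.2 hbij.2), by ext; rfl⟩
  set ψ := hfc.implicitFunction (by simp) hinv with hψ
  have hψu : ψ (e m) = e' n := hfc.implicitFunction_apply_self (by simp) hinv
  have hψc : ContDiffAt ℝ ∞ ψ (e m) := hfc.contDiffAt_implicitFunction (by simp) hinv
  have hec : ContMDiffAt I 𝓘(ℝ, E) ∞ e m := contMDiffAt_extChartAt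
  refine ⟨fun x => e'.symm (ψ (e x)), ?_, by simp only [hψu, hn], ?_⟩
  · refine ContMDiffAt.comp m (g := e'.symm) (by rw [hψu]; exact hes') ?_
    exact ContMDiffAt.comp m (g := ψ) hψc.contMDiffAt hec
  · have h1 := (continuousAt_extChartAt (I := I) m).eventually
      (hfc.eventually_apply_implicitFunction (by simp) hinv)
    filter_upwards [h1, extChartAt_source_mem_nhds (I := I) m] with x hx hxs
    have h2 : e.symm (e x) = x := e.left_inv hxs
    have h3 : f u = F (m, n) := by simp only [hf, hu, hm, hn]
    rw [← h3, ← hx]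
    simp only [hf]
    rw [← he, h2]

end Implicit

/-! ### Coordinate projections of a product manifold -/

section Pi

variable {E : Type*} [NormedAddCommGroup E] [NormedSpace ℝ E]
  {Q : Type*} [TopologicalSpace Q] [ChartedSpace E Q] {ι : Type*} [Fintype ι]

theorem hasMFDerivAt_pi_eval (q : ι → Q) (i : ι) :
    HasMFDerivAt (ModelWithCorners.pi fun _ : ι => 𝓘(ℝ, E)) 𝓘(ℝ, E) (fun x : ι → Q => x i) q
      (ContinuousLinearMap.proj (R := ℝ) (φ := fun _ : ι => E) i) := by
  refine ⟨(continuous_apply i).continuousAt, ?_⟩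
  refine HasFDerivWithinAt.congr_of_eventuallyEq
    (ContinuousLinearMap.proj (R := ℝ) (φ := fun _ : ι => E) i).hasFDerivWithinAt ?_ ?_
  · have h1 : (extChartAt 𝓘(ℝ, E) (q i)).target ∈ 𝓝 (extChartAt 𝓘(ℝ, E) (q i) (q i)) :=
      extChartAt_target_mem_nhds (q i)
    have h2 : Filter.Tendsto (fun y : ι → E => y i)
        (𝓝[Set.range (ModelWithCorners.pi fun _ : ι => 𝓘(ℝ, E))]
          (extChartAt (ModelWithCorners.pi fun _ : ι => 𝓘(ℝ, E)) q q))
        (𝓝 (extChartAt 𝓘(ℝ, E) (q i) (q i))) :=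
      ((continuous_apply i).tendsto _).mono_left nhdsWithin_le_nhds
    filter_upwards [h2 h1] with y hy
    exact (extChartAt 𝓘(ℝ, E) (q i)).right_inv hy
  · exact (extChartAt 𝓘(ℝ, E) (q i)).right_inv
      ((extChartAt 𝓘(ℝ, E) (q i)).map_source (mem_extChartAt_source (q i)))

end Pi

/-! ### Geometry of the principal bundle -/

namespace DiscreteReduction

variable {EG : Type*} [NormedAddCommGroup EG] [NormedSpace ℝ EG]
  {G : Type*} [TopologicalSpace G] [ChartedSpace EG G] [Group G]
  {E : Type*} [NormedAddCommGroup E] [NormedSpace ℝ E]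
  {Q : Type*} [TopologicalSpace Q] [ChartedSpace E Q] [MulAction G Q]
  {EB : Type*} [NormedAddCommGroup EB] [NormedSpace ℝ EB]
  {B : Type*} [TopologicalSpace B] [ChartedSpace EB B]

namespace PrincipalBundle

theorem π_smul (P : PrincipalBundle EG G E Q EB B) (g : G) (q : Q) : P.π (g • q) = P.π q :=
  ((P.π_eq_iff q (g • q)).2 ⟨g, rfl⟩).symm

theorem π_mdifferentiableAt (P : PrincipalBundle EG G E Q EB B) (q : Q) :
    MDifferentiableAt 𝓘(ℝ, E) 𝓘(ℝ, EB) P.π q :=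
  P.π_smooth.mdifferentiableAt (by simp)

/-- Through each point there is a smooth local section, and with it a local trivialization. -/
theorem exists_localSection [LieGroup 𝓘(ℝ, EG) ∞ G] (P : PrincipalBundle EG G E Q EB B) (q : Q) :
    ∃ (O : Set B) (σ : B → Q) (ψ : Q → G), IsOpen O ∧ P.π q ∈ O ∧
      ContMDiffOn 𝓘(ℝ, EB) 𝓘(ℝ, E) ∞ σ O ∧ ContMDiffOn 𝓘(ℝ, E) 𝓘(ℝ, EG) ∞ ψ (P.π ⁻¹' O) ∧
      σ (P.π q) = q ∧ (∀ b ∈ O, P.π (σ b) = b) ∧ (∀ x, P.π x ∈ O → ψ x • σ (P.π x) = x) ∧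
      ∀ g : G, ψ (g • q) = g := by
  obtain ⟨O, φ, hO, hqO, hs, ht, hφ, hφs, hequiv⟩ := P.locally_trivial (P.π q)
  have hq : q ∈ φ.source := by rw [hs]; exact hqO
  have hfst : ∀ x ∈ φ.source, (φ x).1 = P.π x := fun x hx => (hequiv x hx).1
  have hmem : ∀ b ∈ O, ∀ a : G, (b, a) ∈ φ.target := fun b hb a => by
    rw [ht]; exact ⟨hb, trivial⟩
  have hsec : ∀ b ∈ O, ∀ a : G, P.π (φ.symm (b, a)) = b := fun b hb a => by
    rw [← hfst _ (φ.map_target (hmem b hb a)), φ.right_inv (hmem b hb a)]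
  -- Both maps are normalized at `q`: the section keeps the group coordinate of `q`, and `ψ` divides
  -- by that coordinate on the right, which respects left multiplication and gives `ψ (g • q) = g`.
  refine ⟨O, fun b => φ.symm (b, (φ q).2), fun x => (φ x).2 * (φ q).2⁻¹, hO, hqO, ?_, ?_, ?_, ?_,
    ?_, ?_⟩
  · exact hφs.comp (contMDiffOn_id.prodMk contMDiffOn_const) fun b hb => hmem b hb _
  · rw [← hs]
    have h : ContMDiffOn 𝓘(ℝ, E) 𝓘(ℝ, EG) ∞ (fun x => (φ x).2) φ.source :=
      contMDiff_snd.comp_contMDiffOn hφ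
    exact h.mul contMDiffOn_const
  · show φ.symm (P.π q, (φ q).2) = q
    rw [← hfst q hq, Prod.mk.eta, φ.left_inv hq]
  · exact fun b hb => hsec b hb _
  · intro x hx
    have hx' : x ∈ φ.source := by rw [hs]; exact hx
    have h1 := φ.map_target (hmem _ hx (φ q).2)
    have h2 : ∀ g : G, g • φ.symm (P.π x, (φ q).2) ∈ φ.source := fun g => by
      rw [hs, Set.mem_preimage, P.π_smul, hsec _ hx]; exact hx
    refine φ.injOn (h2 _) hx' ?_
    rw [(hequiv _ h1).2, hsec _ hx, φ.right_inv (hmem _ hx _), inv_mul_cancel_right, ← hfst x hx']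
  · intro g
    simp [(hequiv q hq).2]

/-- A continuous local section through `q` pulls a neighbourhood of `q` back to a neighbourhood of
`π q`. -/
theorem isOpenMap_π [LieGroup 𝓘(ℝ, EG) ∞ G] (P : PrincipalBundle EG G E Q EB B) :
    IsOpenMap P.π := by
  refine IsOpenMap.of_nhds_le fun q => ?_
  obtain ⟨O, σ, ψ, hO, hq, hσ, -, hσq, hπσ, -, -⟩ := P.exists_localSection q
  intro s hs
  have h1 : Filter.Tendsto σ (𝓝 (P.π q)) (𝓝 q) := by
    have := (hσ.continuousOn.continuousAt (hO.mem_nhds hq)).tendsto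
    rwa [hσq] at this
  filter_upwards [h1 hs, hO.mem_nhds hq] with b hb hbO
  have : P.π (σ b) ∈ s := hb
  rwa [hπσ b hbO] at this

end PrincipalBundle

theorem contMDiff_smul_const [ContMDiffSMul 𝓘(ℝ, EG) 𝓘(ℝ, E) ∞ G Q] (q : Q) :
    ContMDiff 𝓘(ℝ, EG) 𝓘(ℝ, E) ∞ (fun g : G => g • q) :=
  contMDiff_id.smul contMDiff_const

theorem mem_vertical_iff {q : Q} {v : E} :
    v ∈ vertical EG G E q ↔ ∃ ξ : EG, mfd 𝓘(ℝ, EG) 𝓘(ℝ, E) (fun g : G => g • q) 1 ξ = v :=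
  Iff.rfl

namespace PrincipalBundle

theorem contMDiff_smul [ContMDiffSMul 𝓘(ℝ, EG) 𝓘(ℝ, E) ∞ G Q] (_ : PrincipalBundle EG G E Q EB B)
    (g : G) : ContMDiff 𝓘(ℝ, E) 𝓘(ℝ, E) ∞ (fun q : Q => g • q) :=
  ContMDiffSMul.contMDiff_const_smul (I := 𝓘(ℝ, EG)) g

/-- The group coordinate `ψ` is a left inverse of the orbit map, hence its derivative is one of the
infinitesimal generator map. -/
theorem infGen_injective [LieGroup 𝓘(ℝ, EG) ∞ G] [ContMDiffSMul 𝓘(ℝ, EG) 𝓘(ℝ, E) ∞ G Q]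
    (P : PrincipalBundle EG G E Q EB B) (q : Q) :
    Function.Injective (mfd 𝓘(ℝ, EG) 𝓘(ℝ, E) (fun g : G => g • q) 1) := by
  obtain ⟨O, σ, ψ, hO, hq, hσ, hψs, hσq, hπσ, hψσ, hψ⟩ := P.exists_localSection q
  have h1 : MDifferentiableAt 𝓘(ℝ, E) 𝓘(ℝ, EG) ψ q :=
    (hψs.contMDiffAt ((hO.preimage P.π_smooth.continuous).mem_nhds hq)).mdifferentiableAt (by simp)
  refine Function.LeftInverse.injective (g := mfd 𝓘(ℝ, E) 𝓘(ℝ, EG) ψ q) fun ξ => ?_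
  rw [← mfd_comp_apply h1 ((contMDiff_smul_const q).mdifferentiableAt (by simp)) (one_smul G q) ξ]
  simp only [hψ, mfd_id, ContinuousLinearMap.id_apply]

theorem mfd_π_infGen [ContMDiffSMul 𝓘(ℝ, EG) 𝓘(ℝ, E) ∞ G Q]
    (P : PrincipalBundle EG G E Q EB B) (q : Q) (ξ : EG) :
    mfd 𝓘(ℝ, E) 𝓘(ℝ, EB) P.π q (mfd 𝓘(ℝ, EG) 𝓘(ℝ, E) (fun g : G => g • q) 1 ξ) = 0 := by
  rw [← mfd_comp_apply (P.π_mdifferentiableAt q)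
    ((contMDiff_smul_const q).mdifferentiableAt (by simp)) (one_smul G q) ξ]
  simp only [P.π_smul, mfd_const, zero_apply]

theorem mfd_π_surjective [LieGroup 𝓘(ℝ, EG) ∞ G]
    (P : PrincipalBundle EG G E Q EB B) (q : Q) :
    Function.Surjective (mfd 𝓘(ℝ, E) 𝓘(ℝ, EB) P.π q) := by
  obtain ⟨O, σ, ψ, hO, hq, hσ, hψs, hσq, hπσ, hψσ, hψ⟩ := P.exists_localSection q
  have h1 : MDifferentiableAt 𝓘(ℝ, EB) 𝓘(ℝ, E) σ (P.π q) :=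
    (hσ.contMDiffAt (hO.mem_nhds hq)).mdifferentiableAt (by simp)
  refine Function.RightInverse.surjective (g := mfd 𝓘(ℝ, EB) 𝓘(ℝ, E) σ (P.π q)) fun v => ?_
  rw [← mfd_comp_apply (P.π_mdifferentiableAt q) h1 hσq v]
  have h2 : (fun b => P.π (σ b)) =ᶠ[𝓝 (P.π q)] fun b => b := by
    filter_upwards [hO.mem_nhds hq] with b hb using hπσ b hb
  rw [h2.mfd_eq, mfd_id, ContinuousLinearMap.id_apply]

/-- Differentiate `ψ x • σ (π x) = x` along `v`: the term through `σ ∘ π` vanishes, and what remains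
is the generator of `dψ v`. -/
theorem mem_vertical_of_mfd_π_eq_zero [LieGroup 𝓘(ℝ, EG) ∞ G]
    [ContMDiffSMul 𝓘(ℝ, EG) 𝓘(ℝ, E) ∞ G Q] (P : PrincipalBundle EG G E Q EB B) (q : Q) {v : E}
    (hv : mfd 𝓘(ℝ, E) 𝓘(ℝ, EB) P.π q v = 0) : v ∈ vertical EG G E q := by
  obtain ⟨O, σ, ψ, hO, hq, hσ, hψs, hσq, hπσ, hψσ, hψ⟩ := P.exists_localSection q
  have h1 : MDifferentiableAt 𝓘(ℝ, EB) 𝓘(ℝ, E) σ (P.π q) :=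
    (hσ.contMDiffAt (hO.mem_nhds hq)).mdifferentiableAt (by simp)
  have hnhds := (hO.preimage P.π_smooth.continuous).mem_nhds hq
  have h2 : MDifferentiableAt 𝓘(ℝ, E) 𝓘(ℝ, EG) ψ q :=
    (hψs.contMDiffAt hnhds).mdifferentiableAt (by simp)
  have hψ1 : ψ q = 1 := by simpa using hψ 1
  have h3 : MDifferentiableAt (𝓘(ℝ, EG).prod 𝓘(ℝ, E)) 𝓘(ℝ, E)
      (fun p : G × Q => p.1 • p.2) (1, q) :=
    (ContMDiffSMul.contMDiff_smul (I := 𝓘(ℝ, EG)) (I' := 𝓘(ℝ, E)) (n := ∞)).mdifferentiableAt (by simp)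
  have h4 : (fun x => ψ x • σ (P.π x)) =ᶠ[𝓝 q] fun x => x := by
    filter_upwards [hnhds] with x hx using hψσ x hx
  have h5 := mfd_comp₂_apply h3 h2 (h1.comp q (P.π_mdifferentiableAt q)) hψ1 hσq v
  have h6 := mfd_comp_apply h1 (P.π_mdifferentiableAt q) rfl v
  rw [hv, map_zero] at h6
  refine mem_vertical_iff.2 ⟨mfd 𝓘(ℝ, E) 𝓘(ℝ, EG) ψ q v, ?_⟩
  have h7 : mfd 𝓘(ℝ, E) 𝓘(ℝ, E) (σ ∘ P.π) q v = 0 := h6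
  rw [h7, map_zero, add_zero] at h5
  rw [← h5]
  have h8 := h4.mfd_eq (I := 𝓘(ℝ, E)) (I' := 𝓘(ℝ, E))
  rw [mfd_id] at h8
  exact congrArg (fun A : E →L[ℝ] E => A v) h8

theorem mfd_π_smul [ContMDiffSMul 𝓘(ℝ, EG) 𝓘(ℝ, E) ∞ G Q]
    (P : PrincipalBundle EG G E Q EB B) (g : G) (q : Q) (v : E) :
    mfd 𝓘(ℝ, E) 𝓘(ℝ, EB) P.π (g • q) (mfd 𝓘(ℝ, E) 𝓘(ℝ, E) (fun x : Q => g • x) q v) =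
      mfd 𝓘(ℝ, E) 𝓘(ℝ, EB) P.π q v := by
  rw [← mfd_comp_apply (P.π_mdifferentiableAt _)
    ((P.contMDiff_smul g).mdifferentiableAt (by simp)) rfl v]
  simp only [P.π_smul]

end PrincipalBundle

/-! ### Horizontal lifts of the nonholonomic connection -/

section Splitting

variable [IsManifold 𝓘(ℝ, E) ∞ Q] {S : DiscreteSystem E Q}

theorem Splitting.isCompl_hor_vertical (T : Splitting EG G S) (q : Q) :
    IsCompl (T.hor q) (vertical EG G E q) := by
  have h1 := T.W_compl q
  rw [← T.H_sup q] at h1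
  refine ⟨?_, ?_⟩
  · exact (T.H_disjoint q).disjoint_sup_left_of_disjoint_sup_right h1.disjoint
  · rw [Splitting.hor, codisjoint_iff, sup_assoc]
    exact h1.sup_eq_top

theorem Splitting.hor_smul (T : Splitting EG G S) (g : G) {q : Q}
    {v : TangentSpace 𝓘(ℝ, E) q} (hv : v ∈ T.hor q) :
    mfd 𝓘(ℝ, E) 𝓘(ℝ, E) (fun x : Q => g • x) q v ∈ T.hor (g • q) := by
  obtain ⟨w, hw, h, hh, rfl⟩ := Submodule.mem_sup.1 hv
  change liftedAction g q (w + h) ∈ T.W (g • q) ⊔ T.H (g • q)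
  rw [map_add]
  exact Submodule.add_mem_sup (T.W_inv g q w hw) (T.H_inv g q h hh)

variable [LieGroup 𝓘(ℝ, EG) ∞ G] [ContMDiffSMul 𝓘(ℝ, EG) 𝓘(ℝ, E) ∞ G Q]

/-- The kernel of `dπ` is the vertical space, which `hor` complements. Hence `horLift` never takes
its default value `0`. -/
theorem Splitting.bijective_dπ (P : PrincipalBundle EG G E Q EB B) (T : Splitting EG G S) (q : Q) :
    Function.Bijective ((P.dπ q).domRestrict (T.hor q)) := by
  have hc := T.isCompl_hor_vertical q
  constructor
  · refine LinearMap.ker_eq_bot.1 (LinearMap.ker_eq_bot'.2 fun v hv => ?_)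
    have h1 := P.mem_vertical_of_mfd_π_eq_zero q hv
    exact Subtype.ext (Submodule.disjoint_def.1 hc.disjoint _ v.2 h1)
  · intro u
    obtain ⟨v, hv⟩ : ∃ v : TangentSpace 𝓘(ℝ, E) q, P.dπ q v = u := P.mfd_π_surjective q u
    obtain ⟨h, hh, w, hw, hsum⟩ := Submodule.mem_sup.1
      (hc.sup_eq_top.symm ▸ Submodule.mem_top : v ∈ _)
    obtain ⟨ξ, rfl⟩ := hw
    refine ⟨⟨h, hh⟩, ?_⟩
    have h1 : P.dπ q (infGen EG G q ξ) = 0 := P.mfd_π_infGen q ξ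
    rw [← hsum, map_add, h1, add_zero] at hv
    exact hv

theorem Splitting.horLift_mem (P : PrincipalBundle EG G E Q EB B) (T : Splitting EG G S) (q : Q)
    (v : EB) : horLift P T.hor q v ∈ T.hor q := by
  rw [horLift, dif_pos (T.bijective_dπ P q)]
  exact Subtype.coe_prop _

theorem Splitting.mfd_π_horLift (P : PrincipalBundle EG G E Q EB B) (T : Splitting EG G S) (q : Q)
    (v : EB) : mfd 𝓘(ℝ, E) 𝓘(ℝ, EB) P.π q (horLift P T.hor q v) = v := by
  rw [horLift, dif_pos (T.bijective_dπ P q)]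
  exact (LinearEquiv.ofBijective _ (T.bijective_dπ P q)).apply_symm_apply v

theorem Splitting.horLift_eq (P : PrincipalBundle EG G E Q EB B) (T : Splitting EG G S) {q : Q}
    {v : EB} {h : E} (hh : h ∈ T.hor q) (hv : mfd 𝓘(ℝ, E) 𝓘(ℝ, EB) P.π q h = v) :
    horLift P T.hor q v = h :=
  congrArg Subtype.val ((T.bijective_dπ P q).1
    (a₁ := ⟨horLift P T.hor q v, T.horLift_mem P q v⟩) (a₂ := ⟨h, hh⟩)
    ((T.mfd_π_horLift P q v).trans hv.symm))

theorem Splitting.horLift_smul (P : PrincipalBundle EG G E Q EB B) (T : Splitting EG G S) (g : G)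
    (q : Q) (v : EB) : horLift P T.hor (g • q) v =
      mfd 𝓘(ℝ, E) 𝓘(ℝ, E) (fun x : Q => g • x) q (horLift P T.hor q v) :=
  T.horLift_eq P (T.hor_smul g (T.horLift_mem P q v))
    ((P.mfd_π_smul g q _).trans (T.mfd_π_horLift P q v))

end Splitting

end DiscreteReduction

/-- In finite dimension, a form on `V × V` that is nondegenerate in one argument is so in the other.
`IsGRegular` tests the argument at `q₀`, while the momentum will be differentiated in `q₁`. -/
theorem ContinuousLinearMap.bijective_of_separatingRight {V : Type*} [NormedAddCommGroup V]
    [NormedSpace ℝ V] [FiniteDimensional ℝ V] (A : V →L[ℝ] V →L[ℝ] ℝ)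
    (hA : ∀ x, (∀ y, A y x = 0) → x = 0) : Function.Bijective A := by
  have h1 : Module.finrank ℝ V = Module.finrank ℝ (V →L[ℝ] ℝ) := by
    rw [← (LinearMap.toContinuousLinearMap : (V →ₗ[ℝ] ℝ) ≃ₗ[ℝ] V →L[ℝ] ℝ).finrank_eq]
    exact (Subspace.dual_finrank_eq (K := ℝ) (V := V)).symm
  let B : V →ₗ[ℝ] V →ₗ[ℝ] ℝ := ContinuousLinearMap.coeLM ℝ ∘ₗ A.toLinearMap
  have h2 : Function.Injective B.flip :=
    (injective_iff_map_eq_zero _).2 fun x hx => hA x fun y => congrArg (fun f => f y) hx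
  have h3 : Function.Injective B := LinearMap.flip_surjective_iff₁.1
    ((LinearMap.injective_iff_surjective_of_finrank_eq_finrank
      (Subspace.dual_finrank_eq (K := ℝ) (V := V)).symm).1 h2)
  have h4 : Function.Injective A := fun x y hxy => h3 (by ext z; simp [B, hxy])
  exact ⟨h4, (LinearMap.injective_iff_surjective_of_finrank_eq_finrank (f := A.toLinearMap) h1).1 h4⟩

/-! ### The momentum map and its symmetries -/

namespace DiscreteReduction

variable {EG : Type*} [NormedAddCommGroup EG] [NormedSpace ℝ EG]
  {G : Type*} [TopologicalSpace G] [ChartedSpace EG G] [Group G] [LieGroup 𝓘(ℝ, EG) ∞ G]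
  {E : Type*} [NormedAddCommGroup E] [NormedSpace ℝ E]
  {Q : Type*} [TopologicalSpace Q] [ChartedSpace E Q] [IsManifold 𝓘(ℝ, E) ∞ Q]
  [MulAction G Q] [ContMDiffSMul 𝓘(ℝ, EG) 𝓘(ℝ, E) ∞ G Q]
  {EB : Type*} [NormedAddCommGroup EB] [NormedSpace ℝ EB]
  {B : Type*} [TopologicalSpace B] [ChartedSpace EB B]

namespace DiscreteSystem

theorem L_mdifferentiableAt (S : DiscreteSystem E Q) (p : Q × Q) :
    MDifferentiableAt (𝓘(ℝ, E).prod 𝓘(ℝ, E)) 𝓘(ℝ, ℝ) S.L p :=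
  S.L_smooth.mdifferentiableAt (by simp)

variable (EG G) in
/-- The derivative of `g ↦ L_d (g q₀, q₁)` at the identity: the negative of the momentum map. -/
noncomputable def orbitDeriv (S : DiscreteSystem E Q) (p : Q × Q) : EG →L[ℝ] ℝ :=
  mfd 𝓘(ℝ, EG) 𝓘(ℝ, ℝ) (fun g : G => S.L (g • p.1, p.2)) 1

/-- The differential is taken at the fixed point `1` of `G`, so its values lie in one vector space
and `ContMDiff.mfd_snd_const` applies with parameter `(q₀, q₁)`. -/
theorem contMDiff_orbitDeriv (S : DiscreteSystem E Q) :
    ContMDiff (𝓘(ℝ, E).prod 𝓘(ℝ, E)) 𝓘(ℝ, EG →L[ℝ] ℝ) ∞ (S.orbitDeriv EG G) := by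
  refine ContMDiff.mfd_snd_const (F := fun p : (Q × Q) × G => S.L (p.2 • p.1.1, p.1.2))
    (S.L_smooth.comp ?_) 1
  exact (contMDiff_snd.smul (I := 𝓘(ℝ, EG)) (contMDiff_fst.comp contMDiff_fst)).prodMk
    (contMDiff_snd.comp contMDiff_fst)

omit [LieGroup 𝓘(ℝ, EG) ∞ G] in
theorem mfd_fst_infGen (S : DiscreteSystem E Q) (q₀ q₁ : Q) (ξ : EG) :
    mfd 𝓘(ℝ, E) 𝓘(ℝ, ℝ) (fun q => S.L (q, q₁)) q₀
      (mfd 𝓘(ℝ, EG) 𝓘(ℝ, E) (fun g : G => g • q₀) 1 ξ) = S.orbitDeriv EG G (q₀, q₁) ξ := by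
  have h : MDifferentiableAt 𝓘(ℝ, E) 𝓘(ℝ, ℝ) (fun q => S.L (q, q₁)) q₀ :=
    (S.L_mdifferentiableAt (q₀, q₁)).comp q₀
      (mdifferentiableAt_id.prodMk mdifferentiableAt_const)
  rw [← mfd_comp_apply h ((contMDiff_smul_const q₀).mdifferentiableAt (by simp))
    (one_smul G q₀) ξ]
  rfl

omit [LieGroup 𝓘(ℝ, EG) ∞ G] in
theorem momentum_apply (S : DiscreteSystem E Q) (q₀ q₁ : Q) (ξ : EG) :
    momentum (EG := EG) (G := G) S q₀ q₁ ξ = -S.orbitDeriv EG G (q₀, q₁) ξ :=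
  congrArg Neg.neg (S.mfd_fst_infGen q₀ q₁ ξ)

omit [LieGroup 𝓘(ℝ, EG) ∞ G] in
theorem mem_momentumLevel_iff (S : DiscreteSystem E Q) {μ : GroupLieAlgebra 𝓘(ℝ, EG) G →ₗ[ℝ] ℝ}
    {p : Q × Q} : p ∈ momentumLevel S μ ↔ ∀ ξ : EG, S.orbitDeriv EG G p ξ = -μ ξ := by
  refine ⟨fun h ξ => ?_, fun h => LinearMap.ext fun (ξ : EG) => ?_⟩
  · rw [← congrArg (fun f => f ξ) (show momentum S p.1 p.2 = μ from h)]
    exact (neg_eq_iff_eq_neg.2 (S.momentum_apply p.1 p.2 ξ)).symm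
  · exact (S.momentum_apply p.1 p.2 ξ).trans (neg_eq_iff_eq_neg.2 (h ξ))

end DiscreteSystem

theorem mdifferentiableAt_conj (g w : G) :
    MDifferentiableAt 𝓘(ℝ, EG) 𝓘(ℝ, EG) (fun h : G => g * h * g⁻¹) w :=
  (((contMDiff_const (c := g)).mul contMDiff_id).mul
    (contMDiff_const (c := g⁻¹)) :
    ContMDiff 𝓘(ℝ, EG) 𝓘(ℝ, EG) ∞ (fun h : G => g * h * g⁻¹)).mdifferentiableAt (by simp)

namespace IsSymmetryGroup

variable {S : DiscreteSystem E Q}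

/-- Equivariance of the momentum map: by invariance, `L (h g q₀, g q₁) = L (g⁻¹ h g q₀, q₁)`;
differentiate at `h = 1`. -/
theorem orbitDeriv_smul (hS : IsSymmetryGroup G S) (g : G) (q₀ q₁ : Q) (ξ : EG) :
    S.orbitDeriv EG G (g • q₀, g • q₁) ξ =
      S.orbitDeriv EG G (q₀, q₁)
        (mfd 𝓘(ℝ, EG) 𝓘(ℝ, EG) (fun h : G => g⁻¹ * h * g⁻¹⁻¹) 1 ξ) := by
  have h1 : MDifferentiableAt 𝓘(ℝ, EG) 𝓘(ℝ, ℝ) (fun h : G => S.L (h • q₀, q₁)) 1 :=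
    (S.L_mdifferentiableAt _).comp 1 (((contMDiff_smul_const q₀).mdifferentiableAt
      (by simp)).prodMk mdifferentiableAt_const)
  refine Eq.trans ?_ (mfd_comp_apply h1 (mdifferentiableAt_conj g⁻¹ 1) (by simp) ξ)
  have h2 : (fun h : G => S.L (h • g • q₀, g • q₁)) =
      fun h : G => S.L ((g⁻¹ * h * g⁻¹⁻¹) • q₀, q₁) := by
    funext h
    rw [← hS.L_inv g⁻¹]
    simp [mul_smul]
  exact congrArg (fun f => mfd 𝓘(ℝ, EG) 𝓘(ℝ, ℝ) f 1 ξ) h2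

theorem smul_mem_momentumLevel (hS : IsSymmetryGroup G S)
    {μ : GroupLieAlgebra 𝓘(ℝ, EG) G →ₗ[ℝ] ℝ} (hAd : ∀ g : G, μ ∘ₗ Ad g = μ) (g : G) {q₀ q₁ : Q}
    (h : (q₀, q₁) ∈ momentumLevel S μ) : (g • q₀, g • q₁) ∈ momentumLevel S μ := by
  rw [S.mem_momentumLevel_iff] at h ⊢
  intro ξ
  rw [hS.orbitDeriv_smul, h]
  exact congrArg Neg.neg (congrArg (fun f => f ξ) (hAd g⁻¹))

-- Differentiating `L (g q₀, g q₁) = L (q₀, q₁)` at `g = 1` shows that the two partial derivatives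
-- along the orbits cancel. This is the infinitesimal source of momentum conservation.
omit [LieGroup 𝓘(ℝ, EG) ∞ G] in
theorem mfd_snd_infGen (hS : IsSymmetryGroup G S) (q₀ q₁ : Q) (ξ : EG) :
    mfd 𝓘(ℝ, E) 𝓘(ℝ, ℝ) (fun q => S.L (q₀, q)) q₁
      (mfd 𝓘(ℝ, EG) 𝓘(ℝ, E) (fun g : G => g • q₁) 1 ξ) = -S.orbitDeriv EG G (q₀, q₁) ξ := by
  have h := mfd_comp₂_apply (S.L_mdifferentiableAt (q₀, q₁))
    ((contMDiff_smul_const (EG := EG) (G := G) q₀).mdifferentiableAt (x := 1) (by simp))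
    ((contMDiff_smul_const (EG := EG) (G := G) q₁).mdifferentiableAt (x := 1) (by simp))
    (one_smul G q₀) (one_smul G q₁) ξ
  simp only [hS.L_inv, mfd_const, zero_apply] at h
  rw [S.mfd_fst_infGen] at h
  exact (neg_eq_of_add_eq_zero_right h.symm).symm

end IsSymmetryGroup

/-- `G`-regularity carried to the Lie algebra by the infinitesimal generators; their injectivity at
`q₀` turns a vanishing vertical vector into `ξ = 0`. -/
theorem IsMuGood.bijective_mfd_orbitDeriv [FiniteDimensional ℝ EG]
    (P : PrincipalBundle EG G E Q EB B) {S : DiscreteSystem E Q}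
    {μ : GroupLieAlgebra 𝓘(ℝ, EG) G →ₗ[ℝ] ℝ} (hgood : IsMuGood S μ) (q₀ q₁ : Q) :
    Function.Bijective (mfd 𝓘(ℝ, EG) 𝓘(ℝ, EG →L[ℝ] ℝ)
      (fun h : G => S.orbitDeriv EG G (q₀, h • q₁)) 1) := by
  refine ContinuousLinearMap.bijective_of_separatingRight _ fun ξ hξ => ?_
  have h0 : MDifferentiableAt 𝓘(ℝ, E) 𝓘(ℝ, EG →L[ℝ] ℝ)
      (fun q => S.orbitDeriv EG G (q₀, q)) q₁ :=
    (S.contMDiff_orbitDeriv.mdifferentiableAt (by simp)).comp q₁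
      (mdifferentiableAt_const.prodMk mdifferentiableAt_id)
  refine P.infGen_injective q₀ ?_
  rw [map_zero]
  refine hgood.gregular q₀ q₁ _ ⟨ξ, rfl⟩ ?_
  rintro _ ⟨η, rfl⟩
  have h1 := mfd_comp_apply h0
    ((contMDiff_smul_const (EG := EG) (G := G) q₁).mdifferentiableAt (x := 1) (by simp))
    (one_smul G q₁) η
  have h2 := mfd_comp_apply
    (ContinuousLinearMap.apply ℝ ℝ ξ).mdifferentiableAt h0 rfl
    (mfd 𝓘(ℝ, EG) 𝓘(ℝ, E) (fun g : G => g • q₁) 1 η)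
  rw [← h1, (ContinuousLinearMap.apply ℝ ℝ ξ).hasMFDerivAt.mfd_eq] at h2
  refine Eq.trans ?_ (h2.trans (hξ η))
  exact congrArg (fun f => mfd 𝓘(ℝ, E) 𝓘(ℝ, ℝ) f q₁ _) (funext fun q => S.mfd_fst_infGen q₀ q ξ)

end DiscreteReduction

namespace DiscreteReduction

/-! ### Algebra of the affine discrete connection -/

section Algebra

variable {G : Type*} [Group G] {Q : Type*} [TopologicalSpace Q] [MulAction G Q]
  {Hor U : Set (Q × Q)}

namespace IsConnectionDomain

/-- Uniqueness in `U` makes the choice inside `connForm` immaterial: exhibiting one decomposition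
computes `𝒜_d`. -/
theorem connForm_eq (hU : IsConnectionDomain G Hor U) {p : Q × Q} {g : G}
    (h : (p.1, g⁻¹ • p.2) ∈ Hor ∩ U) : connForm G Hor U p = g := by
  have hex : ∃ g : G, (p.1, g⁻¹ • p.2) ∈ Hor ∩ U := ⟨g, h⟩
  rw [connForm, dif_pos hex]
  exact inv_injective (hU.unique p.1 p.2 _ _ hex.choose_spec h)

theorem connForm_spec (hU : IsConnectionDomain G Hor U) {p : Q × Q} (hp : p ∈ connDom G Hor U) :
    (p.1, (connForm G Hor U p)⁻¹ • p.2) ∈ Hor ∩ U := by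
  obtain ⟨g, hg⟩ := hp
  rwa [hU.connForm_eq hg]

theorem connForm_smul_of_mem (hU : IsConnectionDomain G Hor U) {q₀ q₁ : Q}
    (h : (q₀, q₁) ∈ Hor ∩ U) (w : G) : connForm G Hor U (q₀, w • q₁) = w :=
  hU.connForm_eq (by simpa using h)

theorem connForm_eq_one (hU : IsConnectionDomain G Hor U) {q₀ q₁ : Q}
    (h : (q₀, q₁) ∈ Hor ∩ U) : connForm G Hor U (q₀, q₁) = 1 :=
  hU.connForm_eq (by simpa using h)

end IsConnectionDomain

variable (G) in
omit [TopologicalSpace Q] in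
theorem mem_connDom_of_mem {q₀ q₁ : Q} (h : (q₀, q₁) ∈ Hor ∩ U) : (q₀, q₁) ∈ connDom G Hor U :=
  ⟨1, by simpa using h⟩

variable (G) in
/-- The set `Hor` is invariant under the diagonal action. -/
def IsDiagInvariant (Hor : Set (Q × Q)) : Prop :=
  ∀ (g : G) {q₀ q₁ : Q}, (q₀, q₁) ∈ Hor → (g • q₀, g • q₁) ∈ Hor

namespace IsConnectionDomain

theorem smul_mem (hU : IsConnectionDomain G Hor U) (hinv : IsDiagInvariant G Hor) (g : G)
    {q₀ q₁ : Q} (h : (q₀, q₁) ∈ Hor ∩ U) : (g • q₀, g • q₁) ∈ Hor ∩ U :=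
  ⟨hinv g h.1, hU.invariant g _ _ h.2⟩

theorem connForm_smul (hU : IsConnectionDomain G Hor U) (hinv : IsDiagInvariant G Hor) (g : G)
    {q₀ q₁ : Q} (h : (q₀, q₁) ∈ connDom G Hor U) :
    connForm G Hor U (g • q₀, g • q₁) = g * connForm G Hor U (q₀, q₁) * g⁻¹ := by
  have h1 := hU.smul_mem hinv g (hU.connForm_spec h)
  refine hU.connForm_eq ?_
  convert h1 using 2
  simp [mul_smul]

end IsConnectionDomain

end Algebra

section Lift

variable {EG : Type*} [NormedAddCommGroup EG] [NormedSpace ℝ EG]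
  {G : Type*} [TopologicalSpace G] [ChartedSpace EG G] [Group G]
  {E : Type*} [NormedAddCommGroup E] [NormedSpace ℝ E]
  {Q : Type*} [TopologicalSpace Q] [ChartedSpace E Q] [MulAction G Q]
  {EB : Type*} [NormedAddCommGroup EB] [NormedSpace ℝ EB]
  {B : Type*} [TopologicalSpace B] [ChartedSpace EB B] {Hor U : Set (Q × Q)}

namespace IsConnectionDomain

theorem discLift_eq (hU : IsConnectionDomain G Hor U) (P : PrincipalBundle EG G E Q EB B)
    {q₀ q₁ : Q} (h : (q₀, q₁) ∈ Hor ∩ U) {r₁ : B} (hr : P.π q₁ = r₁) :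
    discLift P Hor U q₀ r₁ = q₁ := by
  have hex : ∃ q₁ : Q, (q₀, q₁) ∈ Hor ∩ U ∧ P.π q₁ = r₁ := ⟨q₁, h, hr⟩
  rw [discLift, dif_pos hex]
  obtain ⟨h1, h2⟩ := hex.choose_spec
  obtain ⟨g, hg⟩ := (P.π_eq_iff _ _).1 (hr.trans h2.symm)
  rw [← hg] at h1 ⊢
  rw [hU.unique q₀ q₁ g 1 h1 (by simpa using h), one_smul]

/-- Existence of the lift need not be assumed: the default value `q₀` is equivariant too. -/
theorem discLift_smul (hU : IsConnectionDomain G Hor U) (P : PrincipalBundle EG G E Q EB B)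
    (hinv : IsDiagInvariant G Hor) (g : G) (q₀ : Q) (r₁ : B) :
    discLift P Hor U (g • q₀) r₁ = g • discLift P Hor U q₀ r₁ := by
  by_cases hex : ∃ q₁ : Q, (q₀, q₁) ∈ Hor ∩ U ∧ P.π q₁ = r₁
  · obtain ⟨q₁, h1, h2⟩ := hex
    rw [hU.discLift_eq P h1 h2,
      hU.discLift_eq P (hU.smul_mem hinv g h1) ((P.π_smul g q₁).trans h2)]
  · have hex' : ¬ ∃ q₁ : Q, (g • q₀, q₁) ∈ Hor ∩ U ∧ P.π q₁ = r₁ := by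
      rintro ⟨q₁, h1, h2⟩
      refine hex ⟨g⁻¹ • q₁, ?_, (P.π_smul _ _).trans h2⟩
      simpa using hU.smul_mem hinv g⁻¹ h1
    rw [discLift, discLift, dif_neg hex, dif_neg hex']

theorem F₁_smul (hU : IsConnectionDomain G Hor U) (P : PrincipalBundle EG G E Q EB B)
    (hinv : IsDiagInvariant G Hor) (g : G) (q₀ : Q) (w : G) (r₁ : B) :
    F₁ P Hor U (g • q₀) (g * w * g⁻¹) r₁ = g • F₁ P Hor U q₀ w r₁ := by
  simp [F₁, hU.discLift_smul P hinv, mul_smul]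

theorem checkL_smul (hU : IsConnectionDomain G Hor U) (P : PrincipalBundle EG G E Q EB B)
    (hinv : IsDiagInvariant G Hor) {L : Q × Q → ℝ}
    (hL : ∀ (g : G) (q₀ q₁ : Q), L (g • q₀, g • q₁) = L (q₀, q₁)) (g : G) (q₀ : Q) (w : G)
    (r₁ : B) : checkL P L Hor U (g • q₀) (g * w * g⁻¹) r₁ = checkL P L Hor U q₀ w r₁ := by
  rw [checkL, hU.F₁_smul P hinv, hL, checkL]

end IsConnectionDomain

omit [TopologicalSpace G] [TopologicalSpace Q] in
theorem ρ_eq_iff {q q' : Q} {w w' : G} :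
    ρ q w = ρ q' w' ↔ ∃ g : G, g • q = q' ∧ g * w * g⁻¹ = w' :=
  (Quotient.eq (r := conjSetoid G Q)).trans (exists_congr fun _ => Prod.mk_inj)

omit [TopologicalSpace G] [TopologicalSpace Q] in
theorem exists_smul_rep (q : Q) (w : G) :
    ∃ g : G, (ρ q w).rep.1 = g • q ∧ (ρ q w).rep.2 = g * w * g⁻¹ := by
  obtain ⟨g, h1, h2⟩ := ρ_eq_iff.1 (Quotient.out_eq (ρ q w)).symm
  exact ⟨g, h1.symm, h2.symm⟩

/-- The chosen point of the fibre can be replaced by any other, since conjugation fixes `1`. -/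
theorem PrincipalBundle.incl_fst (P : PrincipalBundle EG G E Q EB B) (q : Q) (r₁ : B) :
    (incl P (P.π q, r₁)).1 = ρ q 1 := by
  obtain ⟨g, hg⟩ := (P.π_eq_iff _ q).1 (Function.surjInv_eq P.π_surjective (P.π q))
  exact ρ_eq_iff.2 ⟨g, hg, by simp⟩

namespace IsConnectionDomain

theorem hatL_ρ (hU : IsConnectionDomain G Hor U) (P : PrincipalBundle EG G E Q EB B)
    (hinv : IsDiagInvariant G Hor) {L : Q × Q → ℝ}
    (hL : ∀ (g : G) (q₀ q₁ : Q), L (g • q₀, g • q₁) = L (q₀, q₁)) (q₀ : Q) (w : G)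
    (r₁ : B) : hatL P L Hor U (ρ q₀ w) r₁ = checkL P L Hor U q₀ w r₁ := by
  obtain ⟨g, h1, h2⟩ := exists_smul_rep q₀ w
  rw [hatL, h1, h2, hU.checkL_smul P hinv hL]

/-- The formula holds on all of `connDom`, which will be open, and not only on `Hor ∩ U`; therefore
it can be differentiated. -/
theorem breveL_eq (hU : IsConnectionDomain G Hor U) (P : PrincipalBundle EG G E Q EB B)
    (hinv : IsDiagInvariant G Hor) {L : Q × Q → ℝ}
    (hL : ∀ (g : G) (q₀ q₁ : Q), L (g • q₀, g • q₁) = L (q₀, q₁)) {q₀ q₁ : Q}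
    (h : (q₀, q₁) ∈ connDom G Hor U) :
    breveL P L Hor U (P.π q₀, P.π q₁) = L (q₀, (connForm G Hor U (q₀, q₁))⁻¹ • q₁) := by
  rw [breveL, P.incl_fst, hU.hatL_ρ P hinv hL, checkL, F₁, one_smul]
  exact congrArg (fun q => L (q₀, q)) (hU.discLift_eq P (hU.connForm_spec h) (P.π_smul _ _))

theorem mem_breveDom_iff (hU : IsConnectionDomain G Hor U) (P : PrincipalBundle EG G E Q EB B)
    (hinv : IsDiagInvariant G Hor) {q₀ : Q} {r₁ : B} :
    (P.π q₀, r₁) ∈ breveDom P Hor U ↔ ∃ q₁, (q₀, q₁) ∈ Hor ∩ U ∧ P.π q₁ = r₁ := by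
  constructor
  · rintro ⟨⟨a, b⟩, hab, heq⟩
    obtain ⟨h1, h2⟩ := Prod.mk.inj heq
    obtain ⟨g, rfl⟩ := (P.π_eq_iff _ _).1 h1
    exact ⟨g • b, hU.smul_mem hinv g hab, (P.π_smul _ _).trans h2⟩
  · rintro ⟨q₁, h, rfl⟩
    exact ⟨(q₀, q₁), h, rfl⟩

theorem breveDom_eq_image (P : PrincipalBundle EG G E Q EB B) :
    breveDom P Hor U = Prod.map P.π P.π '' connDom G Hor U := by
  ext ⟨r₀, r₁⟩
  constructor
  · rintro ⟨⟨a, b⟩, hab, heq⟩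
    exact ⟨(a, b), mem_connDom_of_mem G hab, heq⟩
  · rintro ⟨⟨a, b⟩, ⟨g, hg⟩, heq⟩
    exact ⟨(a, g⁻¹ • b), hg, by simpa [P.π_smul] using heq⟩

end IsConnectionDomain

end Lift

/-! ### Smoothness of the connection form and of the reduced lagrangian -/

section Smooth

variable {EG : Type*} [NormedAddCommGroup EG] [NormedSpace ℝ EG] [FiniteDimensional ℝ EG]
  {G : Type*} [TopologicalSpace G] [ChartedSpace EG G] [Group G] [LieGroup 𝓘(ℝ, EG) ∞ G]
  {E : Type*} [NormedAddCommGroup E] [NormedSpace ℝ E] [FiniteDimensional ℝ E]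
  {Q : Type*} [TopologicalSpace Q] [ChartedSpace E Q] [IsManifold 𝓘(ℝ, E) ∞ Q]
  [MulAction G Q] [ContMDiffSMul 𝓘(ℝ, EG) 𝓘(ℝ, E) ∞ G Q]
  {EB : Type*} [NormedAddCommGroup EB] [NormedSpace ℝ EB]
  {B : Type*} [TopologicalSpace B] [ChartedSpace EB B]
  {S : DiscreteSystem E Q} {μ : GroupLieAlgebra 𝓘(ℝ, EG) G →ₗ[ℝ] ℝ} {U : Set (Q × Q)}

namespace IsConnectionDomain

/-- Near a pair with decomposition `g`, the implicit function theorem solves `J_d(x₁, h g⁻¹ x₂) = μ`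
for `h` near `1`; openness of `U` keeps the solution inside `U`. -/
theorem exists_smooth_connForm (hU : IsConnectionDomain G (momentumLevel S μ) U)
    (P : PrincipalBundle EG G E Q EB B) (hgood : IsMuGood S μ) {p : Q × Q}
    (hp : p ∈ connDom G (momentumLevel S μ) U) :
    ∃ A : Q × Q → G, ContMDiffAt (𝓘(ℝ, E).prod 𝓘(ℝ, E)) 𝓘(ℝ, EG) ∞ A p ∧
      ∀ᶠ x in 𝓝 p, (x.1, (A x)⁻¹ • x.2) ∈ momentumLevel S μ ∩ U := by
  obtain ⟨g, hg⟩ := hp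
  have : CompleteSpace EG := FiniteDimensional.complete ℝ EG
  have : CompleteSpace E := FiniteDimensional.complete ℝ E
  let F : (Q × Q) × G → EG →L[ℝ] ℝ := fun y =>
    S.orbitDeriv EG G (y.1.1, y.2 • g⁻¹ • y.1.2)
  have hm : ContMDiff (((𝓘(ℝ, E).prod 𝓘(ℝ, E))).prod 𝓘(ℝ, EG)) (𝓘(ℝ, E).prod 𝓘(ℝ, E)) ∞
      (fun y : (Q × Q) × G => (y.1.1, y.2 • g⁻¹ • y.1.2)) :=
    (contMDiff_fst.comp contMDiff_fst).prodMk
      (contMDiff_snd.smul (I := 𝓘(ℝ, EG))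
        ((P.contMDiff_smul g⁻¹).comp (contMDiff_snd.comp contMDiff_fst)))
  obtain ⟨φ, hφ, hφ1, hφF⟩ := ContMDiffAt.exists_implicitFunction (F := F) (m := p) (n := 1)
    (S.contMDiff_orbitDeriv.comp hm).contMDiffAt
    (hgood.bijective_mfd_orbitDeriv P p.1 (g⁻¹ • p.2))
  have hpφ : ContinuousAt (fun x : Q × Q => (x.1, φ x • g⁻¹ • x.2)) p :=
    ContinuousAt.comp (f := fun x : Q × Q => (x, φ x)) (x := p)
      (hm.continuous.continuousAt (x := (p, φ p))) (continuousAt_id.prodMk hφ.continuousAt)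
  -- Chosen so that its inverse is `φ x * g⁻¹`, the element that moves `x.2` into the level set.
  refine ⟨fun x => g * (φ x)⁻¹, contMDiffAt_const.mul hφ.inv, ?_⟩
  have h1 : ∀ᶠ x in 𝓝 p, (x.1, φ x • g⁻¹ • x.2) ∈ U :=
    hpφ.eventually_mem (hU.isOpen.mem_nhds (by rw [hφ1, one_smul]; exact hg.2))
  filter_upwards [h1, hφF] with x hx1 hx2
  have h2 : (g * (φ x)⁻¹)⁻¹ • x.2 = φ x • g⁻¹ • x.2 := by simp [mul_smul]
  rw [h2]
  refine ⟨S.mem_momentumLevel_iff.2 fun ξ => ?_, hx1⟩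
  have h3 : F (p, 1) ξ = -μ ξ := by
    simp only [F, one_smul]
    exact S.mem_momentumLevel_iff.1 hg.1 ξ
  rw [← h3, ← hx2]

theorem isOpen_connDom (hU : IsConnectionDomain G (momentumLevel S μ) U)
    (P : PrincipalBundle EG G E Q EB B) (hgood : IsMuGood S μ) :
    IsOpen (connDom G (momentumLevel S μ) U) := by
  refine isOpen_iff_mem_nhds.2 fun p hp => ?_
  obtain ⟨A, -, hA⟩ := hU.exists_smooth_connForm P hgood hp
  filter_upwards [hA] with x hx using ⟨_, hx⟩

theorem contMDiffAt_connForm (hU : IsConnectionDomain G (momentumLevel S μ) U)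
    (P : PrincipalBundle EG G E Q EB B) (hgood : IsMuGood S μ) {p : Q × Q}
    (hp : p ∈ connDom G (momentumLevel S μ) U) :
    ContMDiffAt (𝓘(ℝ, E).prod 𝓘(ℝ, E)) 𝓘(ℝ, EG) ∞ (connForm G (momentumLevel S μ) U) p := by
  obtain ⟨A, hAs, hA⟩ := hU.exists_smooth_connForm P hgood hp
  refine hAs.congr_of_eventuallyEq ?_
  filter_upwards [hA] with x hx using hU.connForm_eq hx

theorem isOpen_breveDom (hU : IsConnectionDomain G (momentumLevel S μ) U)
    (P : PrincipalBundle EG G E Q EB B) (hgood : IsMuGood S μ) :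
    IsOpen (breveDom P (momentumLevel S μ) U) := by
  rw [breveDom_eq_image]
  exact P.isOpenMap_π.prodMap P.isOpenMap_π _ (hU.isOpen_connDom P hgood)

/-- The second component of the horizontal part, `(q₀, q₁) ↦ 𝒜_d(q₀, q₁)⁻¹ q₁`, is smooth. -/
theorem contMDiffAt_connForm_inv_smul (hU : IsConnectionDomain G (momentumLevel S μ) U)
    (P : PrincipalBundle EG G E Q EB B) (hgood : IsMuGood S μ) {p : Q × Q}
    (hp : p ∈ connDom G (momentumLevel S μ) U) :
    ContMDiffAt (𝓘(ℝ, E).prod 𝓘(ℝ, E)) 𝓘(ℝ, E) ∞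
      (fun x => (connForm G (momentumLevel S μ) U x)⁻¹ • x.2) p :=
  (hU.contMDiffAt_connForm P hgood hp).inv.smul contMDiffAt_snd

/-- Local sections `σ`, `σ'` express the reduced lagrangian as `L (σ, 𝒜_d(σ, σ')⁻¹ σ')`. -/
theorem contMDiffAt_breveL (hU : IsConnectionDomain G (momentumLevel S μ) U)
    (P : PrincipalBundle EG G E Q EB B) (hgood : IsMuGood S μ)
    (hinv : IsDiagInvariant G (momentumLevel S μ)) {r : B × B}
    (hr : r ∈ breveDom P (momentumLevel S μ) U) :
    ContMDiffAt (𝓘(ℝ, EB).prod 𝓘(ℝ, EB)) 𝓘(ℝ, ℝ) ∞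
      (breveL P S.L (momentumLevel S μ) U) r := by
  obtain ⟨⟨q₀, q₁⟩, hq, rfl⟩ := hr
  obtain ⟨O, σ, -, hO, hqO, hσ, -, hσq, hπσ, -, -⟩ := P.exists_localSection q₀
  obtain ⟨O', σ', -, hO', hqO', hσ', -, hσq', hπσ', -, -⟩ := P.exists_localSection q₁
  have hp := mem_connDom_of_mem G hq
  have h1 : ContMDiffAt (𝓘(ℝ, EB).prod 𝓘(ℝ, EB)) (𝓘(ℝ, E).prod 𝓘(ℝ, E)) ∞
      (fun r : B × B => (σ r.1, σ' r.2)) (P.π q₀, P.π q₁) :=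
    ((hσ.contMDiffAt (hO.mem_nhds hqO)).comp (P.π q₀, P.π q₁) contMDiffAt_fst).prodMk
      ((hσ'.contMDiffAt (hO'.mem_nhds hqO')).comp (P.π q₀, P.π q₁) contMDiffAt_snd)
  have h2 : ContMDiffAt (𝓘(ℝ, E).prod 𝓘(ℝ, E)) 𝓘(ℝ, ℝ) ∞
      (fun x : Q × Q => S.L (x.1, (connForm G (momentumLevel S μ) U x)⁻¹ • x.2)) (q₀, q₁) :=
    S.L_smooth.contMDiffAt.comp (q₀, q₁)
      (contMDiffAt_fst.prodMk (hU.contMDiffAt_connForm_inv_smul P hgood hp))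
  have h3 : (σ (P.π q₀), σ' (P.π q₁)) = (q₀, q₁) := by rw [hσq, hσq']
  have h4 := ContMDiffAt.comp (P.π q₀, P.π q₁) (h3.symm ▸ h2) h1
  refine h4.congr_of_eventuallyEq ?_
  have h5 := h1.continuousAt.eventually_mem (s := connDom G (momentumLevel S μ) U)
    ((hU.isOpen_connDom P hgood).mem_nhds (h3.symm ▸ hp))
  filter_upwards [h5, (hO.prod hO').mem_nhds ⟨hqO, hqO'⟩] with r hr1 hr2
  have h6 := hU.breveL_eq P hinv hgood.symmetry.L_inv hr1
  rw [hπσ _ hr2.1, hπσ' _ hr2.2] at h6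
  exact h6

end IsConnectionDomain

end Smooth

end DiscreteReduction

namespace DiscreteReduction

/-! ### The reduced forces and the horizontal derivatives of the lagrangian -/

section Forces

variable {EG : Type*} [NormedAddCommGroup EG] [NormedSpace ℝ EG] [FiniteDimensional ℝ EG]
  {G : Type*} [TopologicalSpace G] [ChartedSpace EG G] [Group G] [LieGroup 𝓘(ℝ, EG) ∞ G]
  {E : Type*} [NormedAddCommGroup E] [NormedSpace ℝ E] [FiniteDimensional ℝ E]
  {Q : Type*} [TopologicalSpace Q] [ChartedSpace E Q] [IsManifold 𝓘(ℝ, E) ∞ Q]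
  [MulAction G Q] [ContMDiffSMul 𝓘(ℝ, EG) 𝓘(ℝ, E) ∞ G Q]
  {EB : Type*} [NormedAddCommGroup EB] [NormedSpace ℝ EB]
  {B : Type*} [TopologicalSpace B] [ChartedSpace EB B]
  {S : DiscreteSystem E Q} {μ : GroupLieAlgebra 𝓘(ℝ, EG) G →ₗ[ℝ] ℝ} {U : Set (Q × Q)}

omit [FiniteDimensional ℝ EG] [LieGroup 𝓘(ℝ, EG) ∞ G] [FiniteDimensional ℝ E]
  [IsManifold 𝓘(ℝ, E) ∞ Q] [ContMDiffSMul 𝓘(ℝ, EG) 𝓘(ℝ, E) ∞ G Q] in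
theorem checkForceMinus_apply (P : PrincipalBundle EG G E Q EB B) (L : Q × Q → ℝ)
    (hor : ∀ q : Q, Submodule ℝ (TangentSpace 𝓘(ℝ, E) q)) (Hor U : Set (Q × Q))
    {q₀ q₁ : Q} {w : G} {r₁ : B} (h : F₁ P Hor U q₀ w r₁ = q₁) (v : EB) :
    checkForceMinus P L hor Hor U q₀ w r₁ v =
      mfd 𝓘(ℝ, EG) 𝓘(ℝ, ℝ) (fun g => checkL P L Hor U q₀ g r₁) w
        (mfd 𝓘(ℝ, E) 𝓘(ℝ, EG) (fun q => connForm G Hor U (q, q₁)) q₀ (horLift P hor q₀ v)) := by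
  subst h
  rfl

omit [FiniteDimensional ℝ EG] [LieGroup 𝓘(ℝ, EG) ∞ G] [FiniteDimensional ℝ E]
  [IsManifold 𝓘(ℝ, E) ∞ Q] [ContMDiffSMul 𝓘(ℝ, EG) 𝓘(ℝ, E) ∞ G Q] in
theorem checkForcePlus_apply (P : PrincipalBundle EG G E Q EB B) (L : Q × Q → ℝ)
    (hor : ∀ q : Q, Submodule ℝ (TangentSpace 𝓘(ℝ, E) q)) (Hor U : Set (Q × Q))
    {q₀ q₁ : Q} {w : G} {r₁ : B} (h : F₁ P Hor U q₀ w r₁ = q₁) (v : EB) :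
    checkForcePlus P L hor Hor U q₀ w r₁ v =
      mfd 𝓘(ℝ, EG) 𝓘(ℝ, ℝ) (fun g => checkL P L Hor U q₀ g r₁) w
        (mfd 𝓘(ℝ, E) 𝓘(ℝ, EG) (fun q => connForm G Hor U (q₀, q)) q₁ (horLift P hor q₁ v)) := by
  subst h
  rfl

omit [FiniteDimensional ℝ EG] [LieGroup 𝓘(ℝ, EG) ∞ G] [FiniteDimensional ℝ E] in
theorem mdifferentiableAt_checkL (P : PrincipalBundle EG G E Q EB B) (S : DiscreteSystem E Q)
    (Hor U : Set (Q × Q)) (q₀ : Q) (w : G) (r₁ : B) :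
    MDifferentiableAt 𝓘(ℝ, EG) 𝓘(ℝ, ℝ) (fun g => checkL P S.L Hor U q₀ g r₁) w :=
  (S.L_mdifferentiableAt _).comp w (mdifferentiableAt_const.prodMk
    ((contMDiff_smul_const (discLift P Hor U q₀ r₁)).mdifferentiableAt (by simp)))

namespace IsConnectionDomain

theorem mdifferentiableAt_connForm_fst (hU : IsConnectionDomain G (momentumLevel S μ) U)
    (P : PrincipalBundle EG G E Q EB B) (hgood : IsMuGood S μ) {q₀ q₁ : Q}
    (hp : (q₀, q₁) ∈ connDom G (momentumLevel S μ) U) :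
    MDifferentiableAt 𝓘(ℝ, E) 𝓘(ℝ, EG) (fun q => connForm G (momentumLevel S μ) U (q, q₁)) q₀ :=
  ((hU.contMDiffAt_connForm P hgood hp).mdifferentiableAt (by simp)).comp q₀
    (mdifferentiableAt_id.prodMk mdifferentiableAt_const)

theorem mdifferentiableAt_connForm_snd (hU : IsConnectionDomain G (momentumLevel S μ) U)
    (P : PrincipalBundle EG G E Q EB B) (hgood : IsMuGood S μ) {q₀ q₁ : Q}
    (hp : (q₀, q₁) ∈ connDom G (momentumLevel S μ) U) :
    MDifferentiableAt 𝓘(ℝ, E) 𝓘(ℝ, EG) (fun q => connForm G (momentumLevel S μ) U (q₀, q)) q₁ :=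
  ((hU.contMDiffAt_connForm P hgood hp).mdifferentiableAt (by simp)).comp q₁
    (mdifferentiableAt_const.prodMk mdifferentiableAt_id)

theorem eventually_mem_connDom_fst (hU : IsConnectionDomain G (momentumLevel S μ) U)
    (P : PrincipalBundle EG G E Q EB B) (hgood : IsMuGood S μ) {q₀ q₁ : Q}
    (hp : (q₀, q₁) ∈ connDom G (momentumLevel S μ) U) :
    ∀ᶠ q in 𝓝 q₀, (q, q₁) ∈ connDom G (momentumLevel S μ) U :=
  ContinuousAt.eventually_mem (f := fun q => (q, q₁)) (by fun_prop)
    ((hU.isOpen_connDom P hgood).mem_nhds hp)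

theorem eventually_mem_connDom_snd (hU : IsConnectionDomain G (momentumLevel S μ) U)
    (P : PrincipalBundle EG G E Q EB B) (hgood : IsMuGood S μ) {q₀ q₁ : Q}
    (hp : (q₀, q₁) ∈ connDom G (momentumLevel S μ) U) :
    ∀ᶠ q in 𝓝 q₁, (q₀, q) ∈ connDom G (momentumLevel S μ) U :=
  ContinuousAt.eventually_mem (f := fun q => (q₀, q)) (by fun_prop)
    ((hU.isOpen_connDom P hgood).mem_nhds hp)

omit [FiniteDimensional ℝ EG] [FiniteDimensional ℝ E] in
theorem mfd_checkL_smul (hU : IsConnectionDomain G (momentumLevel S μ) U)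
    (P : PrincipalBundle EG G E Q EB B) (hgood : IsMuGood S μ)
    (hinv : IsDiagInvariant G (momentumLevel S μ)) (g : G) (q₀ : Q) (w : G) (r₁ : B) (v : EG) :
    mfd 𝓘(ℝ, EG) 𝓘(ℝ, ℝ) (fun h => checkL P S.L (momentumLevel S μ) U (g • q₀) h r₁) (g * w * g⁻¹)
        (mfd 𝓘(ℝ, EG) 𝓘(ℝ, EG) (fun h : G => g * h * g⁻¹) w v) =
      mfd 𝓘(ℝ, EG) 𝓘(ℝ, ℝ) (fun h => checkL P S.L (momentumLevel S μ) U q₀ h r₁) w v := by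
  rw [← mfd_comp_apply (mdifferentiableAt_checkL P S _ U (g • q₀) (g * w * g⁻¹) r₁)
    (mdifferentiableAt_conj g w) rfl v]
  simp only [hU.checkL_smul P hinv hgood.symmetry.L_inv]

/-- Acting by `g` moves the horizontal lift by `g`, conjugates `𝒜_d`, and leaves `Ľ_d` unchanged
under conjugation of `w`; the derivatives of conjugation cancel. -/
theorem checkForceMinus_smul (hU : IsConnectionDomain G (momentumLevel S μ) U)
    (P : PrincipalBundle EG G E Q EB B) (hgood : IsMuGood S μ)
    (hinv : IsDiagInvariant G (momentumLevel S μ)) (T : Splitting EG G S) (g : G) {q₀ q₁ : Q}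
    (hq : (q₀, q₁) ∈ momentumLevel S μ ∩ U) (w : G) (v : EB) :
    checkForceMinus P S.L T.hor (momentumLevel S μ) U (g • q₀) (g * w * g⁻¹) (P.π q₁) v =
      checkForceMinus P S.L T.hor (momentumLevel S μ) U q₀ w (P.π q₁) v := by
  have h1 : F₁ P (momentumLevel S μ) U q₀ w (P.π q₁) = w • q₁ :=
    congrArg (fun q => w • q) (hU.discLift_eq P hq rfl)
  have h2 : (q₀, w • q₁) ∈ connDom G (momentumLevel S μ) U := ⟨w, by simpa using hq⟩
  have h2' : (g • q₀, g • w • q₁) ∈ connDom G (momentumLevel S μ) U :=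
    ⟨g * w * g⁻¹, by simpa [mul_smul] using hU.smul_mem hinv g hq⟩
  have h3 := mfd_comp_apply (hU.mdifferentiableAt_connForm_fst P hgood h2')
    ((P.contMDiff_smul g).mdifferentiableAt (by simp)) rfl (horLift P T.hor q₀ v)
  have h4 := mfd_comp_apply (mdifferentiableAt_conj g w)
    (hU.mdifferentiableAt_connForm_fst P hgood h2) (hU.connForm_smul_of_mem hq w)
    (horLift P T.hor q₀ v)
  have h5 : (fun q => connForm G (momentumLevel S μ) U (g • q, g • w • q₁)) =ᶠ[𝓝 q₀]
      fun q => g * connForm G (momentumLevel S μ) U (q, w • q₁) * g⁻¹ := by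
    filter_upwards [hU.eventually_mem_connDom_fst P hgood h2] with q hq
      using hU.connForm_smul hinv g hq
  rw [checkForceMinus_apply P S.L T.hor _ U ((hU.F₁_smul P hinv g q₀ w _).trans (by rw [h1])) v,
    checkForceMinus_apply P S.L T.hor _ U h1 v, T.horLift_smul P, ← h3, h5.mfd_eq, h4]
  exact hU.mfd_checkL_smul P hgood hinv g q₀ w _ _

theorem checkForcePlus_smul (hU : IsConnectionDomain G (momentumLevel S μ) U)
    (P : PrincipalBundle EG G E Q EB B) (hgood : IsMuGood S μ)
    (hinv : IsDiagInvariant G (momentumLevel S μ)) (T : Splitting EG G S) (g : G) {q₀ q₁ : Q}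
    (hq : (q₀, q₁) ∈ momentumLevel S μ ∩ U) (w : G) (v : EB) :
    checkForcePlus P S.L T.hor (momentumLevel S μ) U (g • q₀) (g * w * g⁻¹) (P.π q₁) v =
      checkForcePlus P S.L T.hor (momentumLevel S μ) U q₀ w (P.π q₁) v := by
  have h1 : F₁ P (momentumLevel S μ) U q₀ w (P.π q₁) = w • q₁ :=
    congrArg (fun q => w • q) (hU.discLift_eq P hq rfl)
  have h2 : (q₀, w • q₁) ∈ connDom G (momentumLevel S μ) U := ⟨w, by simpa using hq⟩
  have h2' : (g • q₀, g • w • q₁) ∈ connDom G (momentumLevel S μ) U :=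
    ⟨g * w * g⁻¹, by simpa [mul_smul] using hU.smul_mem hinv g hq⟩
  have h3 := mfd_comp_apply (hU.mdifferentiableAt_connForm_snd P hgood h2')
    ((P.contMDiff_smul g).mdifferentiableAt (by simp)) rfl (horLift P T.hor (w • q₁) v)
  have h4 := mfd_comp_apply (mdifferentiableAt_conj g w)
    (hU.mdifferentiableAt_connForm_snd P hgood h2) (hU.connForm_smul_of_mem hq w)
    (horLift P T.hor (w • q₁) v)
  have h5 : (fun q => connForm G (momentumLevel S μ) U (g • q₀, g • q)) =ᶠ[𝓝 (w • q₁)]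
      fun q => g * connForm G (momentumLevel S μ) U (q₀, q) * g⁻¹ := by
    filter_upwards [hU.eventually_mem_connDom_snd P hgood h2] with q hq
      using hU.connForm_smul hinv g hq
  rw [checkForcePlus_apply P S.L T.hor _ U ((hU.F₁_smul P hinv g q₀ w _).trans (by rw [h1])) v,
    checkForcePlus_apply P S.L T.hor _ U h1 v, T.horLift_smul P, ← h3, h5.mfd_eq, h4]
  exact hU.mfd_checkL_smul P hgood hinv g q₀ w _ _

theorem hatForceMinus_ρ (hU : IsConnectionDomain G (momentumLevel S μ) U)
    (P : PrincipalBundle EG G E Q EB B) (hgood : IsMuGood S μ)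
    (hinv : IsDiagInvariant G (momentumLevel S μ)) (T : Splitting EG G S) {q₀ q₁ : Q}
    (hq : (q₀, q₁) ∈ momentumLevel S μ ∩ U) (w : G) (v : EB) :
    hatForceMinus P S.L T.hor (momentumLevel S μ) U (ρ q₀ w) (P.π q₁) v =
      checkForceMinus P S.L T.hor (momentumLevel S μ) U q₀ w (P.π q₁) v := by
  obtain ⟨g, h1, h2⟩ := exists_smul_rep q₀ w
  refine Eq.trans ?_ (hU.checkForceMinus_smul P hgood hinv T g hq w v)
  rw [← h1, ← h2]
  rfl

theorem hatForcePlus_ρ (hU : IsConnectionDomain G (momentumLevel S μ) U)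
    (P : PrincipalBundle EG G E Q EB B) (hgood : IsMuGood S μ)
    (hinv : IsDiagInvariant G (momentumLevel S μ)) (T : Splitting EG G S) {q₀ q₁ : Q}
    (hq : (q₀, q₁) ∈ momentumLevel S μ ∩ U) (w : G) (v : EB) :
    hatForcePlus P S.L T.hor (momentumLevel S μ) U (ρ q₀ w) (P.π q₁) v =
      checkForcePlus P S.L T.hor (momentumLevel S μ) U q₀ w (P.π q₁) v := by
  obtain ⟨g, h1, h2⟩ := exists_smul_rep q₀ w
  refine Eq.trans ?_ (hU.checkForcePlus_smul P hgood hinv T g hq w v)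
  rw [← h1, ← h2]
  rfl

theorem breveForceMinus_apply (hU : IsConnectionDomain G (momentumLevel S μ) U)
    (P : PrincipalBundle EG G E Q EB B) (hgood : IsMuGood S μ)
    (hinv : IsDiagInvariant G (momentumLevel S μ)) (T : Splitting EG G S) {q₀ q₁ : Q}
    (hq : (q₀, q₁) ∈ momentumLevel S μ ∩ U) (v : EB) :
    breveForceMinus P S.L T.hor (momentumLevel S μ) U (P.π q₀) (P.π q₁) v =
      checkForceMinus P S.L T.hor (momentumLevel S μ) U q₀ 1 (P.π q₁) v := by
  rw [← hU.hatForceMinus_ρ P hgood hinv T hq, ← P.incl_fst q₀ (P.π q₁)]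
  rfl

theorem breveForcePlus_apply (hU : IsConnectionDomain G (momentumLevel S μ) U)
    (P : PrincipalBundle EG G E Q EB B) (hgood : IsMuGood S μ)
    (hinv : IsDiagInvariant G (momentumLevel S μ)) (T : Splitting EG G S) {q₀ q₁ : Q}
    (hq : (q₀, q₁) ∈ momentumLevel S μ ∩ U) (v : EB) :
    breveForcePlus P S.L T.hor (momentumLevel S μ) U (P.π q₀) (P.π q₁) v =
      checkForcePlus P S.L T.hor (momentumLevel S μ) U q₀ 1 (P.π q₁) v := by
  rw [← hU.hatForcePlus_ρ P hgood hinv T hq, ← P.incl_fst q₀ (P.π q₁)]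
  rfl

theorem mdifferentiableAt_breveL (hU : IsConnectionDomain G (momentumLevel S μ) U)
    (P : PrincipalBundle EG G E Q EB B) (hgood : IsMuGood S μ)
    (hinv : IsDiagInvariant G (momentumLevel S μ)) {q₀ q₁ : Q}
    (hq : (q₀, q₁) ∈ momentumLevel S μ ∩ U) :
    MDifferentiableAt (𝓘(ℝ, EB).prod 𝓘(ℝ, EB)) 𝓘(ℝ, ℝ)
      (breveL P S.L (momentumLevel S μ) U) (P.π q₀, P.π q₁) :=
  (hU.contMDiffAt_breveL P hgood hinv ⟨(q₀, q₁), hq, rfl⟩).mdifferentiableAt (by simp)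

/-- `D₁L_d` along a horizontal lift is `D₁L̆_d` plus the force `F̆_d⁻`. -/
theorem mfd_L_fst_horLift (hU : IsConnectionDomain G (momentumLevel S μ) U)
    (P : PrincipalBundle EG G E Q EB B) (hgood : IsMuGood S μ)
    (hinv : IsDiagInvariant G (momentumLevel S μ)) (T : Splitting EG G S) {q₀ q₁ : Q}
    (hq : (q₀, q₁) ∈ momentumLevel S μ ∩ U) (v : EB) :
    mfd 𝓘(ℝ, E) 𝓘(ℝ, ℝ) (fun q => S.L (q, q₁)) q₀ (horLift P T.hor q₀ v) =
      mfd 𝓘(ℝ, EB) 𝓘(ℝ, ℝ) (fun r => breveL P S.L (momentumLevel S μ) U (r, P.π q₁)) (P.π q₀) v +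
        breveForceMinus P S.L T.hor (momentumLevel S μ) U (P.π q₀) (P.π q₁) v := by
  have hp := mem_connDom_of_mem G hq
  have hd : discLift P (momentumLevel S μ) U q₀ (P.π q₁) = q₁ := hU.discLift_eq P hq rfl
  have hA := hU.connForm_eq_one hq
  have hlift : MDifferentiableAt 𝓘(ℝ, E) 𝓘(ℝ, E)
      (fun q => (connForm G (momentumLevel S μ) U (q, q₁))⁻¹ • q₁) q₀ :=
    ((hU.contMDiffAt_connForm_inv_smul P hgood hp).mdifferentiableAt (by simp)).comp q₀
      (mdifferentiableAt_id.prodMk mdifferentiableAt_const)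
  -- Substituting `g = 𝒜_d(q, q₁)` in this function of `(q, g)` gives back `L (q, q₁)`, so the chain
  -- rule splits the derivative in two.
  have hΦ : MDifferentiableAt (𝓘(ℝ, E).prod 𝓘(ℝ, EG)) 𝓘(ℝ, ℝ) (fun x : Q × G =>
      S.L (x.1, x.2 • (connForm G (momentumLevel S μ) U (x.1, q₁))⁻¹ • q₁)) (q₀, 1) := by
    refine (S.L_mdifferentiableAt _).comp (q₀, 1) (mdifferentiableAt_fst.prodMk ?_)
    exact ((contMDiff_smul (I := 𝓘(ℝ, EG)) (I' := 𝓘(ℝ, E)) (n := ∞)).mdifferentiableAt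
      (by simp)).comp (q₀, (1 : G)) (mdifferentiableAt_snd.prodMk
        (hlift.comp (q₀, (1 : G)) mdifferentiableAt_fst))
  have h1 := mfd_comp₂_apply hΦ (mdifferentiableAt_id (x := q₀))
    (hU.mdifferentiableAt_connForm_fst P hgood hp) rfl hA (horLift P T.hor q₀ v)
  -- With the group variable frozen at `1` only the horizontal part of the pair remains, which is
  -- the reduced lagrangian.
  have h2 : (fun q => S.L (q, (1 : G) • (connForm G (momentumLevel S μ) U (q, q₁))⁻¹ • q₁))
      =ᶠ[𝓝 q₀] fun q => breveL P S.L (momentumLevel S μ) U (P.π q, P.π q₁) := by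
    filter_upwards [hU.eventually_mem_connDom_fst P hgood hp] with q hq
    rw [one_smul, hU.breveL_eq P hinv hgood.symmetry.L_inv hq]
  have h3 := mfd_comp_apply (g := fun r => breveL P S.L (momentumLevel S μ) U (r, P.π q₁))
    (MDifferentiableAt.comp (g := breveL P S.L (momentumLevel S μ) U) (f := fun r => (r, P.π q₁))
      (P.π q₀) (hU.mdifferentiableAt_breveL P hgood hinv hq)
      (mdifferentiableAt_id.prodMk mdifferentiableAt_const))
    (P.π_mdifferentiableAt q₀) rfl (horLift P T.hor q₀ v)
  rw [T.mfd_π_horLift P] at h3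
  have h4 : mfd 𝓘(ℝ, E) 𝓘(ℝ, E) (id : Q → Q) q₀ (horLift P T.hor q₀ v) = horLift P T.hor q₀ v :=
    congrArg (fun f : E →L[ℝ] E => f (horLift P T.hor q₀ v)) (mfd_id q₀)
  simp only [id, smul_inv_smul] at h1
  rw [hU.breveForceMinus_apply P hgood hinv T hq, checkForceMinus_apply P S.L T.hor _ U
    (show F₁ P (momentumLevel S μ) U q₀ 1 (P.π q₁) = q₁ by rw [F₁, hd, one_smul]), h1, h2.mfd_eq]
  -- With `q` frozen at `q₀`, the function of the group variable is `Ľ_d(q₀, ·, π q₁)`: this term is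
  -- the force.
  refine congrArg₂ (· + ·) ((congrArg _ h4).trans h3) ?_
  simp only [checkL, F₁, hd, hA, inv_one, one_smul]

/-- `D₂L_d` along a horizontal lift is `D₂L̆_d` plus the force `F̆_d⁺`. -/
theorem mfd_L_snd_horLift (hU : IsConnectionDomain G (momentumLevel S μ) U)
    (P : PrincipalBundle EG G E Q EB B) (hgood : IsMuGood S μ)
    (hinv : IsDiagInvariant G (momentumLevel S μ)) (T : Splitting EG G S) {q₀ q₁ : Q}
    (hq : (q₀, q₁) ∈ momentumLevel S μ ∩ U) (v : EB) :
    mfd 𝓘(ℝ, E) 𝓘(ℝ, ℝ) (fun q => S.L (q₀, q)) q₁ (horLift P T.hor q₁ v) =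
      mfd 𝓘(ℝ, EB) 𝓘(ℝ, ℝ) (fun r => breveL P S.L (momentumLevel S μ) U (P.π q₀, r)) (P.π q₁) v +
        breveForcePlus P S.L T.hor (momentumLevel S μ) U (P.π q₀) (P.π q₁) v := by
  have hp := mem_connDom_of_mem G hq
  have hd : discLift P (momentumLevel S μ) U q₀ (P.π q₁) = q₁ := hU.discLift_eq P hq rfl
  have hA := hU.connForm_eq_one hq
  have hlift : MDifferentiableAt 𝓘(ℝ, E) 𝓘(ℝ, E)
      (fun q => (connForm G (momentumLevel S μ) U (q₀, q))⁻¹ • q) q₁ :=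
    ((hU.contMDiffAt_connForm_inv_smul P hgood hp).mdifferentiableAt (by simp)).comp q₁
      (mdifferentiableAt_const.prodMk mdifferentiableAt_id)
  -- The same factorization, now with the second point of the pair varying.
  have hΦ : MDifferentiableAt (𝓘(ℝ, E).prod 𝓘(ℝ, EG)) 𝓘(ℝ, ℝ) (fun x : Q × G =>
      S.L (q₀, x.2 • (connForm G (momentumLevel S μ) U (q₀, x.1))⁻¹ • x.1)) (q₁, 1) := by
    refine (S.L_mdifferentiableAt _).comp (q₁, 1) (mdifferentiableAt_const.prodMk ?_)
    exact ((contMDiff_smul (I := 𝓘(ℝ, EG)) (I' := 𝓘(ℝ, E)) (n := ∞)).mdifferentiableAt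
      (by simp)).comp (q₁, (1 : G)) (mdifferentiableAt_snd.prodMk
        (hlift.comp (q₁, (1 : G)) mdifferentiableAt_fst))
  have h1 := mfd_comp₂_apply hΦ (mdifferentiableAt_id (x := q₁))
    (hU.mdifferentiableAt_connForm_snd P hgood hp) rfl hA (horLift P T.hor q₁ v)
  have h2 : (fun q => S.L (q₀, (1 : G) • (connForm G (momentumLevel S μ) U (q₀, q))⁻¹ • q))
      =ᶠ[𝓝 q₁] fun q => breveL P S.L (momentumLevel S μ) U (P.π q₀, P.π q) := by
    filter_upwards [hU.eventually_mem_connDom_snd P hgood hp] with q hq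
    rw [one_smul, hU.breveL_eq P hinv hgood.symmetry.L_inv hq]
  have h3 := mfd_comp_apply (g := fun r => breveL P S.L (momentumLevel S μ) U (P.π q₀, r))
    (MDifferentiableAt.comp (g := breveL P S.L (momentumLevel S μ) U) (f := fun r => (P.π q₀, r))
      (P.π q₁) (hU.mdifferentiableAt_breveL P hgood hinv hq)
      (mdifferentiableAt_const.prodMk mdifferentiableAt_id))
    (P.π_mdifferentiableAt q₁) rfl (horLift P T.hor q₁ v)
  rw [T.mfd_π_horLift P] at h3
  have h4 : mfd 𝓘(ℝ, E) 𝓘(ℝ, E) (id : Q → Q) q₁ (horLift P T.hor q₁ v) = horLift P T.hor q₁ v :=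
    congrArg (fun f : E →L[ℝ] E => f (horLift P T.hor q₁ v)) (mfd_id q₁)
  simp only [id, smul_inv_smul] at h1
  rw [hU.breveForcePlus_apply P hgood hinv T hq, checkForcePlus_apply P S.L T.hor _ U
    (show F₁ P (momentumLevel S μ) U q₀ 1 (P.π q₁) = q₁ by rw [F₁, hd, one_smul]), h1, h2.mfd_eq]
  refine congrArg₂ (· + ·) ((congrArg _ h4).trans h3) ?_
  simp only [checkL, F₁, hd, hA, inv_one, one_smul]

end IsConnectionDomain

end Forces

end DiscreteReduction

namespace DiscreteReduction

/-! ### Variational principles and pointwise equations -/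

section Variational

variable {E : Type*} [NormedAddCommGroup E] [NormedSpace ℝ E]
  {Q : Type*} [TopologicalSpace Q] [ChartedSpace E Q]

/-- The differential of the discrete action is the sum of the partial differentials. -/
theorem dAction_eq_sum {L : Q × Q → ℝ} {N : ℕ} {q : Fin (N + 1) → Q}
    (hL : ∀ k : Fin N, MDifferentiableAt (𝓘(ℝ, E).prod 𝓘(ℝ, E)) 𝓘(ℝ, ℝ) L
      (q k.castSucc, q k.succ)) (δq : ∀ k, TangentSpace 𝓘(ℝ, E) (q k)) :
    dAction L N q δq = ∑ k : Fin N, (partial₁ L (q k.castSucc) (q k.succ) (δq k.castSucc) +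
      partial₂ L (q k.castSucc) (q k.succ) (δq k.succ)) := by
  have h1 : ∀ k : Fin N, HasMFDerivAt (ModelWithCorners.pi fun _ : Fin (N + 1) => 𝓘(ℝ, E)) 𝓘(ℝ, ℝ)
      (fun x : Fin (N + 1) → Q => L (x k.castSucc, x k.succ)) q
      (mfd (ModelWithCorners.pi fun _ : Fin (N + 1) => 𝓘(ℝ, E)) 𝓘(ℝ, ℝ)
        (fun x : Fin (N + 1) → Q => L (x k.castSucc, x k.succ)) q :) := fun k =>
    ((hL k).comp q ((hasMFDerivAt_pi_eval q k.castSucc).mdifferentiableAt.prodMk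
      (hasMFDerivAt_pi_eval q k.succ).mdifferentiableAt)).hasMFDerivAt_mfd
  have h2 := (HasMFDerivAt.sum (t := Finset.univ) fun k _ => h1 k).mfd_eq
  have h3 : action L N = ∑ k : Fin N, fun x : Fin (N + 1) → Q => L (x k.castSucc, x k.succ) := by
    funext x
    simp [action]
  rw [← h3] at h2
  have h4 := congrArg (fun f : (Fin (N + 1) → E) →L[ℝ] ℝ => f δq) h2
  have h5 : ∀ (A : Fin N → (Fin (N + 1) → E) →L[ℝ] ℝ) (v : Fin (N + 1) → E),
      (∑ k, A k) v = ∑ k, A k v := fun A v => by simp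
  refine h4.trans ((h5 _ δq).trans (Finset.sum_congr rfl fun k _ => ?_))
  refine (mfd_comp₂_apply (hL k) (hasMFDerivAt_pi_eval q k.castSucc).mdifferentiableAt
    (hasMFDerivAt_pi_eval q k.succ).mdifferentiableAt rfl rfl δq).trans ?_
  rw [(hasMFDerivAt_pi_eval q k.castSucc).mfd_eq, (hasMFDerivAt_pi_eval q k.succ).mfd_eq]
  rfl

/-- Discrete integration by parts: the sum over edges becomes a sum over interior vertices. The
boundary hypotheses are conditional on `0 < N`, so that `N = 0` is covered. -/
theorem sum_add_eq_of_boundary_eq_zero {N : ℕ} (a b : Fin N → ℝ)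
    (ha : ∀ h : 0 < N, a ⟨0, h⟩ = 0) (hb : ∀ h : 0 < N, b ⟨N - 1, by omega⟩ = 0) :
    ∑ k, (a k + b k) = ∑ k : Fin (N - 1), (a ⟨k + 1, by omega⟩ + b ⟨k, by omega⟩) := by
  cases N with
  | zero => simp
  | succ M =>
    rw [Finset.sum_add_distrib, Fin.sum_univ_succ a, Fin.sum_univ_castSucc b]
    have h1 : a 0 = 0 := ha M.succ_pos
    have h2 : b (Fin.last M) = 0 := hb M.succ_pos
    rw [h1, h2, zero_add, add_zero, ← Finset.sum_add_distrib]
    rfl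

theorem dAction_eq_sum_interior {L : Q × Q → ℝ} {N : ℕ} {q : Fin (N + 1) → Q}
    (hL : ∀ k : Fin N, MDifferentiableAt (𝓘(ℝ, E).prod 𝓘(ℝ, E)) 𝓘(ℝ, ℝ) L
      (q k.castSucc, q k.succ)) {δq : ∀ k, TangentSpace 𝓘(ℝ, E) (q k)}
    (h0 : δq 0 = 0) (hN : δq (Fin.last N) = 0) :
    dAction L N q δq = ∑ k : Fin (N - 1),
      (partial₁ L (q (i₁ (add_two_le k))) (q (i₂ (add_two_le k))) (δq (i₁ (add_two_le k)))
        + partial₂ L (q (i₀ (add_two_le k))) (q (i₁ (add_two_le k)))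
            (δq (i₁ (add_two_le k)))) := by
  rw [dAction_eq_sum hL, sum_add_eq_of_boundary_eq_zero]
  · rfl
  · intro h
    exact (congrArg _ h0).trans (map_zero _)
  · intro h
    cases N with
    | zero => exact absurd h (lt_irrefl 0)
    | succ M => exact (congrArg _ hN).trans (map_zero _)

/-- The `δq_k` at interior points are independent, so the sum vanishes for all admissible variations
exactly when each term does. -/
theorem forcedVariationalPrinciple_iff {L : Q × Q → ℝ}
    {D : ∀ q : Q, Submodule ℝ (TangentSpace 𝓘(ℝ, E) q)}
    {fm : ∀ q₀ _q₁ : Q, TangentSpace 𝓘(ℝ, E) q₀ →ₗ[ℝ] ℝ}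
    {fp : ∀ _q₀ q₁ : Q, TangentSpace 𝓘(ℝ, E) q₁ →ₗ[ℝ] ℝ}
    {N : ℕ} {q : Fin (N + 1) → Q}
    (hL : ∀ k : Fin N, MDifferentiableAt (𝓘(ℝ, E).prod 𝓘(ℝ, E)) 𝓘(ℝ, ℝ) L
      (q k.castSucc, q k.succ)) :
    ForcedVariationalPrinciple L D fm fp q ↔ ForcedLagrangeDAlembert L D fm fp q := by
  have key : ∀ δq : ∀ k, TangentSpace 𝓘(ℝ, E) (q k), IsAdmissible D q δq →
      (dAction L N q δq = -∑ k : Fin (N - 1),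
        (fm (q (i₁ (add_two_le k))) (q (i₂ (add_two_le k)))
          + fp (q (i₀ (add_two_le k))) (q (i₁ (add_two_le k)))) (δq (i₁ (add_two_le k))) ↔
      ∑ k : Fin (N - 1), (partial₁ L (q (i₁ (add_two_le k))) (q (i₂ (add_two_le k)))
          (δq (i₁ (add_two_le k)))
        + partial₂ L (q (i₀ (add_two_le k))) (q (i₁ (add_two_le k))) (δq (i₁ (add_two_le k)))
        + fp (q (i₀ (add_two_le k))) (q (i₁ (add_two_le k))) (δq (i₁ (add_two_le k)))
        + fm (q (i₁ (add_two_le k))) (q (i₂ (add_two_le k))) (δq (i₁ (add_two_le k)))) = 0) := by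
    intro δq hδ
    rw [dAction_eq_sum_interior hL hδ.1 hδ.2.1, eq_neg_iff_add_eq_zero, ← Finset.sum_add_distrib]
    refine iff_of_eq (congrArg (· = 0) (Finset.sum_congr rfl fun k _ => ?_))
    simp only [LinearMap.add_apply]
    ring
  constructor
  · intro hvar k h
    rw [Submodule.mem_dualAnnihilator]
    intro v hv
    -- The variation moves only the vertex `k + 1`, which is neither end point since `k + 2 ≤ N`.
    have hadm : IsAdmissible D q (Function.update 0 (i₁ h) v) := by
      refine ⟨?_, ?_, fun j => ?_⟩
      · exact Function.update_of_ne (by simp [Fin.ext_iff]) _ _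
      · exact Function.update_of_ne (by simp [Fin.ext_iff]; omega) _ _
      · by_cases hj : j = i₁ h
        · subst hj
          rwa [Function.update_self]
        · rw [Function.update_of_ne hj]
          exact (D (q j)).zero_mem
    have h1 := (key _ hadm).1 (hvar _ hadm)
    rw [Finset.sum_eq_single (⟨k, by omega⟩ : Fin (N - 1))] at h1
    · rwa [Function.update_self] at h1
    · intro j _ hj
      rw [Function.update_of_ne]
      · simp only [Pi.zero_apply, map_zero, add_zero]
      · intro heq
        exact hj (Fin.ext (by simpa [Fin.ext_iff] using heq))
    · simp
  · intro hLD δq hδ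
    refine (key δq hδ).2 (Finset.sum_eq_zero fun k _ => ?_)
    exact (Submodule.mem_dualAnnihilator _).1 (hLD k (add_two_le k)) _ (hδ.2.2 _)

theorem variationalPrinciple_iff {L : Q × Q → ℝ}
    {D : ∀ q : Q, Submodule ℝ (TangentSpace 𝓘(ℝ, E) q)} {N : ℕ} {q : Fin (N + 1) → Q}
    (hL : ∀ k : Fin N, MDifferentiableAt (𝓘(ℝ, E).prod 𝓘(ℝ, E)) 𝓘(ℝ, ℝ) L
      (q k.castSucc, q k.succ)) :
    VariationalPrinciple L D q ↔ LagrangeDAlembert L D q := by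
  have h := forcedVariationalPrinciple_iff (D := D) (fm := fun _ _ => 0) (fp := fun _ _ => 0) hL
  simp only [ForcedVariationalPrinciple, ForcedLagrangeDAlembert, add_zero, LinearMap.zero_apply,
    Finset.sum_const_zero, neg_zero] at h
  exact h

end Variational

/-! ### Comparison of the constraints and equations on `Q` and on `Q/G` -/

section Reduction

variable {EG : Type*} [NormedAddCommGroup EG] [NormedSpace ℝ EG] [FiniteDimensional ℝ EG]
  {G : Type*} [TopologicalSpace G] [ChartedSpace EG G] [Group G] [LieGroup 𝓘(ℝ, EG) ∞ G]
  {E : Type*} [NormedAddCommGroup E] [NormedSpace ℝ E] [FiniteDimensional ℝ E]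
  {Q : Type*} [TopologicalSpace Q] [ChartedSpace E Q] [IsManifold 𝓘(ℝ, E) ∞ Q]
  [MulAction G Q] [ContMDiffSMul 𝓘(ℝ, EG) 𝓘(ℝ, E) ∞ G Q]
  {EB : Type*} [NormedAddCommGroup EB] [NormedSpace ℝ EB]
  {B : Type*} [TopologicalSpace B] [ChartedSpace EB B]
  {S : DiscreteSystem E Q} {μ : GroupLieAlgebra 𝓘(ℝ, EG) G →ₗ[ℝ] ℝ} {Hor U : Set (Q × Q)}

omit [FiniteDimensional ℝ EG] [LieGroup 𝓘(ℝ, EG) ∞ G] [FiniteDimensional ℝ E]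
  [IsManifold 𝓘(ℝ, E) ∞ Q] in
theorem PrincipalBundle.map_dπ_le_smul (P : PrincipalBundle EG G E Q EB B)
    {D : ∀ q : Q, Submodule ℝ (TangentSpace 𝓘(ℝ, E) q)} (hD : IsInvariant G D) (g : G) {q : Q}
    {v : EB} (hv : v ∈ (D q).map (P.dπ q)) :
    v ∈ (D (g • q)).map (P.dπ (g • q)) := by
  obtain ⟨w, hw, rfl⟩ := hv
  exact ⟨liftedAction g q w, hD g q w hw, P.mfd_π_smul g q w⟩

-- By invariance of `D`, all terms of the supremum over the fibre coincide.
omit [FiniteDimensional ℝ EG] [LieGroup 𝓘(ℝ, EG) ∞ G] [FiniteDimensional ℝ E]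
  [IsManifold 𝓘(ℝ, E) ∞ Q] in
theorem PrincipalBundle.breveD_eq (P : PrincipalBundle EG G E Q EB B)
    {D : ∀ q : Q, Submodule ℝ (TangentSpace 𝓘(ℝ, E) q)} (hD : IsInvariant G D) (q : Q) :
    breveD P D (P.π q) = (D q).map (P.dπ q) := by
  refine le_antisymm (iSup_le ?_)
    (le_iSup_of_le (⟨q, rfl⟩ : {q' : Q // P.π q' = P.π q}) le_rfl)
  rintro ⟨q', hq'⟩
  obtain ⟨g, rfl⟩ := (P.π_eq_iff _ _).1 hq'
  intro v hv
  exact P.map_dπ_le_smul hD g hv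

omit [FiniteDimensional ℝ EG] [LieGroup 𝓘(ℝ, EG) ∞ G] [FiniteDimensional ℝ E]
  [IsManifold 𝓘(ℝ, E) ∞ Q] [ContMDiffSMul 𝓘(ℝ, EG) 𝓘(ℝ, E) ∞ G Q] in
theorem IsConnectionDomain.mem_breveDd_iff (hU : IsConnectionDomain G Hor U)
    (P : PrincipalBundle EG G E Q EB B) (hinv : IsDiagInvariant G Hor) {Dd : Set (Q × Q)}
    (hDd : IsDiagInvariant G Dd) {q₀ q₁ : Q} (hq : (q₀, q₁) ∈ Hor ∩ U) :
    (P.π q₀, P.π q₁) ∈ breveDd P Dd Hor U ↔ (q₀, q₁) ∈ Dd := by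
  have h0 : incl P (P.π q₀, P.π q₁) = (ρ q₀ (1 : G), P.π q₁) :=
    Prod.ext (P.incl_fst q₀ (P.π q₁)) rfl
  rw [breveDd, Set.mem_preimage, h0]
  constructor
  · rintro ⟨⟨a, b⟩, ⟨hab, hdom⟩, heq⟩
    obtain ⟨h1, h2⟩ := Prod.mk.inj heq
    obtain ⟨g, h3, h4⟩ := ρ_eq_iff.1 h1
    -- A conjugate of `𝒜_d(a, b)` is `1`, so `(a, b)` itself lies in `Hor ∩ U`. Its translate by `g`
    -- starts at `q₀` and ends over `π q₁`, hence ends at `q₁` by uniqueness of the lift.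
    have h5 : connForm G Hor U (a, b) = 1 := by
      rw [mul_inv_eq_one, mul_eq_left] at h4
      exact h4
    have h6 := hU.connForm_spec hdom
    rw [h5, inv_one, one_smul] at h6
    have h7 := hU.smul_mem hinv g h6
    have h8 := hDd g hab
    change g • a = q₀ at h3
    rw [h3] at h7 h8
    have h9 := hU.discLift_eq P h7 ((P.π_smul g b).trans h2)
    rw [hU.discLift_eq P hq rfl] at h9
    rwa [h9]
  · intro h
    exact ⟨(q₀, q₁), ⟨h, mem_connDom_of_mem G hq⟩, by simp only [Upsilon, hU.connForm_eq_one hq]⟩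

/-- At an interior point of a curve, the Lagrange-d'Alembert condition upstairs is the reduced one
with forces. -/
theorem IsConnectionDomain.mem_dualAnnihilator_iff
    (hU : IsConnectionDomain G (momentumLevel S μ) U)
    (P : PrincipalBundle EG G E Q EB B) (hgood : IsMuGood S μ)
    (hinv : IsDiagInvariant G (momentumLevel S μ)) (T : Splitting EG G S) {q₀ q₁ q₂ : Q}
    (h01 : (q₀, q₁) ∈ momentumLevel S μ ∩ U) (h12 : (q₁, q₂) ∈ momentumLevel S μ ∩ U) :
    partial₁ S.L q₁ q₂ + partial₂ S.L q₀ q₁ ∈ (S.D q₁).dualAnnihilator ↔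
      partial₁ (breveL P S.L (momentumLevel S μ) U) (P.π q₁) (P.π q₂)
        + partial₂ (breveL P S.L (momentumLevel S μ) U) (P.π q₀) (P.π q₁)
        + breveForcePlus P S.L T.hor (momentumLevel S μ) U (P.π q₀) (P.π q₁)
        + breveForceMinus P S.L T.hor (momentumLevel S μ) U (P.π q₁) (P.π q₂)
      ∈ (breveD P S.D (P.π q₁)).dualAnnihilator := by
  rw [P.breveD_eq hgood.symmetry.D_inv, Submodule.mem_dualAnnihilator,
    Submodule.mem_dualAnnihilator]
  simp only [LinearMap.add_apply]
  -- Both edges at `q₁` have momentum `μ`: the contributions are `-μ ξ` and `μ ξ`.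
  have hvert : ∀ ξ : GroupLieAlgebra 𝓘(ℝ, EG) G, partial₁ (E := E) S.L q₁ q₂ (infGen EG G q₁ ξ) +
      partial₂ (E := E) S.L q₀ q₁ (infGen EG G q₁ ξ) = 0 := by
    intro (ξ : EG)
    have h1 := (S.mfd_fst_infGen q₁ q₂ ξ).trans (S.mem_momentumLevel_iff.1 h12.1 ξ)
    have h2 := (hgood.symmetry.mfd_snd_infGen q₀ q₁ ξ).trans
      (congrArg Neg.neg (S.mem_momentumLevel_iff.1 h01.1 ξ))
    exact (congrArg₂ (· + ·) h1 h2).trans (add_neg_cancel _)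
  -- A vector of `H` is the horizontal lift of its projection, so both derivative formulas apply to
  -- it.
  have hhor : ∀ h : TangentSpace 𝓘(ℝ, E) q₁, h ∈ T.H q₁ →
      partial₁ S.L q₁ q₂ h + partial₂ S.L q₀ q₁ h =
        partial₁ (breveL P S.L (momentumLevel S μ) U) (P.π q₁) (P.π q₂) (P.dπ q₁ h)
        + partial₂ (breveL P S.L (momentumLevel S μ) U) (P.π q₀) (P.π q₁) (P.dπ q₁ h)
        + breveForcePlus P S.L T.hor (momentumLevel S μ) U (P.π q₀) (P.π q₁) (P.dπ q₁ h)
        + breveForceMinus P S.L T.hor (momentumLevel S μ) U (P.π q₁) (P.π q₂) (P.dπ q₁ h) := by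
    intro h hh
    have hmem : h ∈ T.hor q₁ := Submodule.mem_sup_right hh
    have h0 : horLift P T.hor q₁ (P.dπ q₁ h) = h := T.horLift_eq P hmem rfl
    have h1 := hU.mfd_L_fst_horLift P hgood hinv T h12 (P.dπ q₁ h)
    have h2 := hU.mfd_L_snd_horLift P hgood hinv T h01 (P.dπ q₁ h)
    rw [h0] at h1 h2
    refine (congrArg₂ (· + ·) h1 h2).trans ?_
    rw [add_add_add_comm, add_comm (breveForceMinus _ _ _ _ _ _ _ _), ← add_assoc]
    rfl
  constructor
  · rintro hann _ ⟨v, hv, rfl⟩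
    rw [← T.H_sup q₁] at hv
    obtain ⟨h, hh, _, ⟨ξ, rfl⟩, rfl⟩ := Submodule.mem_sup.1 hv
    have h1 : P.dπ q₁ (infGen EG G q₁ ξ) = 0 := P.mfd_π_infGen q₁ ξ
    rw [map_add, h1, add_zero, ← hhor h hh]
    exact hann h (T.H_sup q₁ ▸ Submodule.mem_sup_left hh)
  · intro hann v hv
    rw [← T.H_sup q₁] at hv
    obtain ⟨h, hh, _, ⟨ξ, rfl⟩, rfl⟩ := Submodule.mem_sup.1 hv
    rw [map_add, map_add, add_add_add_comm, hvert, add_zero, hhor h hh]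
    exact hann _ ⟨h, T.H_sup q₁ ▸ Submodule.mem_sup_left hh, rfl⟩

end Reduction

end DiscreteReduction

/-! ### The reduction theorem -/

open DiscreteReduction in
theorem mainTheorem7
    {EG : Type*} [NormedAddCommGroup EG] [NormedSpace ℝ EG] [FiniteDimensional ℝ EG]
    {G : Type*} [TopologicalSpace G] [ChartedSpace EG G] [Group G] [LieGroup 𝓘(ℝ, EG) ∞ G]
    [T2Space G] [SecondCountableTopology G]
    {E : Type*} [NormedAddCommGroup E] [NormedSpace ℝ E] [FiniteDimensional ℝ E]
    {Q : Type*} [TopologicalSpace Q] [ChartedSpace E Q] [IsManifold 𝓘(ℝ, E) ∞ Q]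
    [T2Space Q] [SecondCountableTopology Q]
    {EB : Type*} [NormedAddCommGroup EB] [NormedSpace ℝ EB] [FiniteDimensional ℝ EB]
    {B : Type*} [TopologicalSpace B] [ChartedSpace EB B] [IsManifold 𝓘(ℝ, EB) ∞ B]
    [T2Space B] [SecondCountableTopology B]
    [MulAction G Q] [ContMDiffSMul 𝓘(ℝ, EG) 𝓘(ℝ, E) ∞ G Q]
    (P : PrincipalBundle EG G E Q EB B)
    (S : DiscreteSystem E Q)
    (μ : GroupLieAlgebra 𝓘(ℝ, EG) G →ₗ[ℝ] ℝ)
    (hgood : IsMuGood S μ)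
    (hAd : ∀ g : G, μ ∘ₗ Ad g = μ)
    (T : Splitting EG G S)
    (Hor U : Set (Q × Q))
    (hHor : Hor = momentumLevel S μ)
    (hU : IsConnectionDomain G Hor U) :
    -- the reduced data are well defined, and smooth on open domains
    (IsOpen (connDom G Hor U) ∧
      ContMDiffOn (𝓘(ℝ, E).prod 𝓘(ℝ, E)) 𝓘(ℝ, EG) ∞ (connForm G Hor U) (connDom G Hor U) ∧
      (∀ (q₀ : Q) (w₀ : G) (r₁ : B),
        hatL P S.L Hor U (ρ q₀ w₀) r₁ = checkL P S.L Hor U q₀ w₀ r₁) ∧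
      (∀ (q₀ : Q) (w₀ : G) (r₁ : B), (P.π q₀, r₁) ∈ breveDom P Hor U →
        hatForceMinus P S.L T.hor Hor U (ρ q₀ w₀) r₁
          = checkForceMinus P S.L T.hor Hor U q₀ w₀ r₁ ∧
        hatForcePlus P S.L T.hor Hor U (ρ q₀ w₀) r₁
          = checkForcePlus P S.L T.hor Hor U q₀ w₀ r₁) ∧
      (∀ q : Q, breveD P S.D (P.π q) = (S.D q).map (P.dπ q)) ∧
      IsOpen (breveDom P Hor U) ∧
      ContMDiffOn (𝓘(ℝ, EB).prod 𝓘(ℝ, EB)) 𝓘(ℝ, ℝ) ∞ (breveL P S.L Hor U)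
        (breveDom P Hor U)) ∧
    -- the equivalence
    ∀ (N : ℕ) (q : Fin (N + 1) → Q),
      (∀ k : Fin N, momentum S (q k.castSucc) (q k.succ) = μ ∧ (q k.castSucc, q k.succ) ∈ U) →
      List.TFAE
        [ SatisfiesConstraints S.Dd q ∧ VariationalPrinciple S.L S.D q,
          SatisfiesConstraints S.Dd q ∧ LagrangeDAlembert S.L S.D q,
          ForcedVariationalPrinciple (breveL P S.L Hor U) (breveD P S.D)
              (breveForceMinus P S.L T.hor Hor U) (breveForcePlus P S.L T.hor Hor U)
              (fun k => P.π (q k)) ∧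
            SatisfiesConstraints (breveDd P S.Dd Hor U) (fun k => P.π (q k)),
          ForcedLagrangeDAlembert (breveL P S.L Hor U) (breveD P S.D)
              (breveForceMinus P S.L T.hor Hor U) (breveForcePlus P S.L T.hor Hor U)
              (fun k => P.π (q k)) ∧
            SatisfiesConstraints (breveDd P S.Dd Hor U) (fun k => P.π (q k)) ] := by
  subst hHor
  -- `Ad`-invariance of `μ` enters only here.
  have hinv : IsDiagInvariant G (momentumLevel S μ) := fun g _ _ h =>
    hgood.symmetry.smul_mem_momentumLevel hAd g h
  have hL := hgood.symmetry.L_inv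
  refine ⟨⟨hU.isOpen_connDom P hgood,
    fun p hp => (hU.contMDiffAt_connForm P hgood hp).contMDiffWithinAt,
    fun q₀ w₀ r₁ => hU.hatL_ρ P hinv hL q₀ w₀ r₁, ?_, P.breveD_eq hgood.symmetry.D_inv,
    hU.isOpen_breveDom P hgood,
    fun r hr => (hU.contMDiffAt_breveL P hgood hinv hr).contMDiffWithinAt⟩, ?_⟩
  · intro q₀ w₀ r₁ hr
    obtain ⟨q₁, hq, rfl⟩ := (hU.mem_breveDom_iff P hinv).1 hr
    exact ⟨LinearMap.ext fun v => hU.hatForceMinus_ρ P hgood hinv T hq w₀ v,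
      LinearMap.ext fun v => hU.hatForcePlus_ρ P hgood hinv T hq w₀ v⟩
  · intro N q hq
    have hmem : ∀ k : Fin N, (q k.castSucc, q k.succ) ∈ momentumLevel S μ ∩ U := hq
    have hconstr : SatisfiesConstraints (breveDd P S.Dd (momentumLevel S μ) U)
        (fun k => P.π (q k)) ↔ SatisfiesConstraints S.Dd q :=
      forall_congr' fun k => hU.mem_breveDd_iff P hinv
        (fun g _ _ h => hgood.symmetry.Dd_inv g _ _ h) (hmem k)
    have hLD : LagrangeDAlembert S.L S.D q ↔
        ForcedLagrangeDAlembert (breveL P S.L (momentumLevel S μ) U) (breveD P S.D)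
          (breveForceMinus P S.L T.hor (momentumLevel S μ) U)
          (breveForcePlus P S.L T.hor (momentumLevel S μ) U) (fun k => P.π (q k)) :=
      -- The edges `k` and `k + 1` are the two that meet at the interior vertex `k + 1`.
      forall_congr' fun k => forall_congr' fun h => hU.mem_dualAnnihilator_iff P hgood hinv T
        (hmem ⟨k, by omega⟩) (hmem ⟨k + 1, by omega⟩)
    tfae_have 1 ↔ 2 :=
      and_congr_right fun _ => variationalPrinciple_iff fun k => S.L_mdifferentiableAt _
    tfae_have 3 ↔ 4 := and_congr_left fun _ =>
      forcedVariationalPrinciple_iff fun k => hU.mdifferentiableAt_breveL P hgood hinv (hmem k)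
    tfae_have 2 ↔ 4 := by rw [hconstr, hLD, and_comm]
    tfae_finish
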